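/- A Floyd function is a function $f:\{1,2,\dots\}\to\mathbb R_{>0}$, extended by $f(0):=f(1)$, with $\sum_{n\ge 1} f(n)<\infty$ and such that for some $\lambda>0$ one has $f(n)\ge f(n+1)\ge\lambda f(n)$ for all $n\ge1$. Let $G$ be a group with a finite generating set $S$, let $d$ be the word metric of $S$, and give each edge $\{g,h\}$ of the Cayley graph of $(G,S)$ the length $f(d(1,\{g,h\}))$. Let $d_f(g,h)$ be the infimum of the lengths of the edge paths from $g$ to $h$. The Floyd boundary $\partial_f(G)=\partial_f(G,S)$ is the set of points of the Cauchy completion for $d_f$ that do not lie in $G$, with the subspace topology. **Theorem.** Let $A_1,B_1,A_2,B_2$ be infinite groups with finite generating sets $S_{A_1},S_{B_1},S_{A_2},S_{B_2}$, and let $G_i=A_i*B_i$ for $i=1,2$. Let $f_1$ and $f_2$ be Floyd functions such that $\partial_{f_1}(A_1,S_{A_1})\cong\partial_{f_2}(A_2,S_{A_2})$ and $\partial_{f_1}(B_1,S_{B_1})\cong\partial_{f_2}(B_2,S_{B_2})$, where $\cong$ means homeomorphic. Then $$\partial_{f_1}(G_1,\,S_{A_1}\cup S_{B_1})\cong\partial_{f_2}(G_2,\,S_{A_2}\cup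 S_{B_2}).$$ If moreover $\sup_n f_i(n)/f_i(2n)<\infty$ for $i=1,2$, then $\partial_{f_1}(G_1,S_1)\cong\partial_{f_2}(G_2,S_2)$ for all finite generating sets $S_1$ of $G_1$ and $S_2$ of $G_2$. -/

import Mathlib

/-- A Floyd function: positive and summable, with `f n ≥ f (n + 1) ≥ lam * f n` for some `lam > 0`,
and with the convention `f 0 = f 1`. -/
structure IsFloydFunction (f : ℕ → ℝ) : Prop where
  pos : ∀ n, 0 < f n
  summable : Summable f
  decay : ∃ lam : ℝ, 0 < lam ∧ ∀ n, 1 ≤ n → f (n + 1) ≤ f n ∧ lam * f n ≤ f (n + 1)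
  zero : f 0 = f 1

/-- `S` is a finite generating set of the group `G`. -/
def IsFiniteGeneratingSet {G : Type*} [Group G] (S : Set G) : Prop :=
  S.Finite ∧ Subgroup.closure S = ⊤

/-- The word length `d(1, g)` of `g`, that is, its distance to `1` in the Cayley graph. -/
noncomputable def wordLength {G : Type*} [Group G] (S : Set G) (g : G) : ℕ :=
  (SimpleGraph.mulCayley S).dist 1 g

/-- The Floyd length `f (d(1, {g, h}))` of an edge with end points `g` and `h`. -/
noncomputable def floydEdgeLength {G : Type*} [Group G] (f : ℕ → ℝ) (S : Set G) (g h : G) : ℝ :=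
  f (min (wordLength S g) (wordLength S h))

/-- The Floyd length of an edge path of the Cayley graph: the sum of the lengths of its edges. -/
noncomputable def floydLength {G : Type*} [Group G] (f : ℕ → ℝ) (S : Set G) {g h : G}
    (p : (SimpleGraph.mulCayley S).Walk g h) : ℝ :=
  (p.darts.map fun e => floydEdgeLength f S e.fst e.snd).sum

/-- The Floyd distance: the infimum of the Floyd lengths of the edge paths from `g` to `h`. (It is
valued in `[0, ∞]` so that it makes sense for every `S`; if `S` generates `G`, it is finite.) -/
noncomputable def floydEDist {G : Type*} [Group G] (f : ℕ → ℝ) (S : Set G) (g h : G) : ENNReal :=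
  ⨅ p : (SimpleGraph.mulCayley S).Walk g h, ENNReal.ofReal (floydLength f S p)

theorem floydEDist_self {G : Type*} [Group G] (f : ℕ → ℝ) (S : Set G) (g : G) :
    floydEDist f S g g = 0 := by
  refine le_antisymm (iInf_le_of_le SimpleGraph.Walk.nil ?_) zero_le
  simp [floydLength]

theorem floydEDist_comm {G : Type*} [Group G] (f : ℕ → ℝ) (S : Set G) (g h : G) :
    floydEDist f S g h = floydEDist f S h g := by
  have length_reverse : ∀ {u v : G} (p : (SimpleGraph.mulCayley S).Walk u v),
      floydLength f S p.reverse = floydLength f S p := fun p => by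
    unfold floydLength
    rw [SimpleGraph.Walk.darts_reverse, List.map_reverse, List.sum_reverse, List.map_map]
    congr 2
    funext e
    simp [floydEdgeLength, min_comm]
  have key : ∀ u v : G, floydEDist f S u v ≤ floydEDist f S v u := fun u v => by
    refine le_iInf fun p => iInf_le_of_le p.reverse ?_
    rw [length_reverse]
  exact le_antisymm (key g h) (key h g)

theorem floydEDist_triangle {G : Type*} [Group G] (f : ℕ → ℝ) (S : Set G) (g h k : G) :
    floydEDist f S g k ≤ floydEDist f S g h + floydEDist f S h k := by
  refine ENNReal.le_iInf_add_iInf fun p q => iInf_le_of_le (p.append q) ?_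
  have length_append : floydLength f S (p.append q) = floydLength f S p + floydLength f S q := by
    simp [floydLength, SimpleGraph.Walk.darts_append]
  rw [length_append]
  exact ENNReal.ofReal_add_le

/-- The group `G`, seen as the vertex set of its Cayley graph with the Floyd metric. -/
structure FloydSpace {G : Type*} [Group G] (f : ℕ → ℝ) (S : Set G) where
  /-- the underlying group element -/
  val : G

noncomputable instance FloydSpace.instPseudoEMetricSpace {G : Type*} [Group G] (f : ℕ → ℝ)
    (S : Set G) : PseudoEMetricSpace (FloydSpace f S) where
  edist x y := floydEDist f S x.val y.val
  edist_self x := floydEDist_self f S x.val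
  edist_comm x y := floydEDist_comm f S x.val y.val
  edist_triangle x y z := floydEDist_triangle f S x.val y.val z.val

/-- The Floyd boundary `∂_f(G)` with respect to `S`: the points of the Cauchy completion of `G` for
the Floyd metric that do not come from `G`, with the subspace topology. (The edges of the Cayley
graph are compact and their Floyd lengths tend to `0` at infinity, so that completing the
metric graph instead of its vertex set adds the same points.) -/
def FloydBoundary {G : Type*} [Group G] (f : ℕ → ℝ) (S : Set G) : Type _ :=
  {x : UniformSpace.Completion (FloydSpace f S) //
    x ∉ Set.range ((↑) : FloydSpace f S → UniformSpace.Completion (FloydSpace f S))}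

noncomputable instance FloydBoundary.instTopologicalSpace {G : Type*} [Group G] (f : ℕ → ℝ)
    (S : Set G) : TopologicalSpace (FloydBoundary f S) :=
  instTopologicalSpaceSubtype

/-- The generating set `S ∪ T` of the free product `A ∗ B`. -/
def freeProductGenerators {A B : Type*} [Group A] [Group B] (S : Set A) (T : Set B) :
    Set (Monoid.Coprod A B) :=
  Monoid.Coprod.inl '' S ∪ Monoid.Coprod.inr '' T

/-! The Floyd boundary of an infinite group already determines its Floyd completion as a uniform
space, and the completion of a free product can be rebuilt from those of the factors.

For the first point, the completion is compact (`IsFloydFunction.totallyBounded`) and metrizable,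
and the group sits in it as a dense set of isolated points (`IsFloydFunction.eq_of_edist_lt`). For
two compactifications of countably infinite sets by such isolated points, a homeomorphism of the
remainders is always induced by a bijection of the isolated points (`exists_equiv_tendsto`): points
are matched when they lie near corresponding boundary points, and Schröder–Bernstein turns the two
matchings into one bijection. By compactness this bijection is a uniform equivalence, and swapping
two isolated points makes it send `1` to `1`.

For the second point, based bijections of the factors act letter by letter on reduced words. The
resulting bijection of the free products is uniformly continuous
(`Monoid.CoprodI.Word.uniformContinuous_vertex`): two points that are close stay close under the
retractions to the finitely many cosets of factors based near `1`, and whatever happens beyond these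
cosets is bounded by a tail of the series of the Floyd function. The inverse is of the same kind, so
the completions, and with them the boundaries, correspond.

Edges of the Cayley graph multiply on the right, while reduced words are acted on from the left. An
element `g` is therefore represented by the reduced word of `g⁻¹`: an edge affects only the first
letter, and the suffixes of the word are the points where a geodesic from `1` to `g` passes between
cosets.

For a doubling Floyd function, the identity of the group is Lipschitz between the Floyd metrics of
any two finite generating sets. -/

open scoped ENNReal NNReal Topology Uniformity
open Filter

/-! ### Word lengths and geodesics in Cayley graphs. -/

section CayleyGraph

variable {G : Type*} [Group G] {S : Set G}

theorem mulCayley_adj_mul_left (a : G) {g h : G} (H : (SimpleGraph.mulCayley S).Adj g h) :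
    (SimpleGraph.mulCayley S).Adj (a * g) (a * h) := by
  rw [SimpleGraph.mulCayley_adj'] at H ⊢
  obtain ⟨hne, s, hs, h | h⟩ := H
  · exact ⟨by simpa using hne, s, hs, Or.inl (by rw [mul_assoc, h])⟩
  · exact ⟨by simpa using hne, s, hs, Or.inr (by rw [mul_assoc, ← h])⟩

/-- Left translation as an endomorphism of the Cayley graph. -/
def mulCayleyTranslate (S : Set G) (a : G) :
    SimpleGraph.mulCayley S →g SimpleGraph.mulCayley S where
  toFun x := a * x
  map_rel' h := mulCayley_adj_mul_left a h

theorem mulCayley_reachable_mul {s : G} (hs : s ∈ S) (a : G) :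
    (SimpleGraph.mulCayley S).Reachable a (a * s) := by
  by_cases h : a = a * s
  · rw [← h]
  · exact SimpleGraph.Adj.reachable
      ((SimpleGraph.mulCayley_adj' _ _ _).2 ⟨h, s, hs, Or.inl rfl⟩)

theorem mulCayley_preconnected (hS : Subgroup.closure S = ⊤) :
    (SimpleGraph.mulCayley S).Preconnected := by
  have key : ∀ g : G, ∀ a : G, (SimpleGraph.mulCayley S).Reachable a (a * g) := by
    intro g
    have hg : g ∈ Subgroup.closure S := hS ▸ Subgroup.mem_top g
    induction hg using Subgroup.closure_induction with
    | mem x hx => exact mulCayley_reachable_mul hx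
    | one => intro a; simp
    | mul x y _ _ hx hy => intro a; rw [← mul_assoc]; exact (hx a).trans (hy _)
    | inv x _ hx => intro a; simpa using (hx (a * x⁻¹)).symm
  intro g h
  simpa using key (g⁻¹ * h) g

theorem mulCayley_dist_mul_left (hS : Subgroup.closure S = ⊤) (a g h : G) :
    (SimpleGraph.mulCayley S).dist (a * g) (a * h) = (SimpleGraph.mulCayley S).dist g h := by
  have key : ∀ a g h : G, (SimpleGraph.mulCayley S).dist (a * g) (a * h) ≤
      (SimpleGraph.mulCayley S).dist g h := by
    intro a g h
    obtain ⟨p, hp⟩ := (mulCayley_preconnected hS g h).exists_walk_length_eq_dist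
    rw [← hp, ← SimpleGraph.Walk.length_map (mulCayleyTranslate S a) p]
    exact SimpleGraph.dist_le _
  refine le_antisymm (key a g h) ?_
  simpa using key a⁻¹ (a * g) (a * h)

theorem wordLength_one : wordLength S (1 : G) = 0 := by
  simp [wordLength]

theorem mulCayley_dist_eq (hS : Subgroup.closure S = ⊤) (g h : G) :
    (SimpleGraph.mulCayley S).dist g h = wordLength S (g⁻¹ * h) := by
  rw [wordLength, ← mulCayley_dist_mul_left hS g⁻¹ g h, inv_mul_cancel]

theorem wordLength_mul_le (hS : Subgroup.closure S = ⊤) (g h : G) :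
    wordLength S (g * h) ≤ wordLength S g + wordLength S h := by
  have h1 := SimpleGraph.Reachable.dist_triangle_left
    (mulCayley_preconnected hS 1 g) (g * h)
  rwa [mulCayley_dist_eq hS g, inv_mul_cancel_left] at h1

theorem wordLength_inv (hS : Subgroup.closure S = ⊤) (g : G) :
    wordLength S g⁻¹ = wordLength S g := by
  have := mulCayley_dist_eq hS g 1
  rw [mul_one] at this
  rw [← this, wordLength, SimpleGraph.dist_comm]

theorem wordLength_le_one {s : G} (hs : s ∈ S) : wordLength S s ≤ 1 := by
  by_cases h : 1 = s
  · rw [← h, wordLength_one]; exact zero_le_one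
  · refine (SimpleGraph.dist_eq_one_iff_adj.2 ?_).le
    exact (SimpleGraph.mulCayley_adj' _ _ _).2 ⟨h, s, hs, Or.inl (one_mul _)⟩

theorem wordLength_mul_gen_le (hS : Subgroup.closure S = ⊤) {s : G} (hs : s ∈ S) (g : G) :
    wordLength S (g * s) ≤ wordLength S g + 1 :=
  (wordLength_mul_le hS g s).trans (by gcongr; exact wordLength_le_one hs)

theorem wordLength_le_mul_gen (hS : Subgroup.closure S = ⊤) {s : G} (hs : s ∈ S) (g : G) :
    wordLength S g ≤ wordLength S (g * s) + 1 := by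
  have h := wordLength_mul_le hS (g * s) s⁻¹
  rw [mul_inv_cancel_right, wordLength_inv hS] at h
  exact h.trans (by gcongr; exact wordLength_le_one hs)

/-- A function on `G` vanishing at `1` and `1`-Lipschitz along the edges of the Cayley graph is
bounded by the word length. -/
theorem le_wordLength (hS : Subgroup.closure S = ⊤) (l : G → ℕ) (h1 : l 1 = 0)
    (h : ∀ g, ∀ s ∈ S, l (g * s) ≤ l g + 1 ∧ l g ≤ l (g * s) + 1) (g : G) :
    l g ≤ wordLength S g := by
  have key : ∀ {u v : G} (p : (SimpleGraph.mulCayley S).Walk u v), l v ≤ l u + p.length := by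
    intro u v p
    induction p with
    | nil => simp
    | @cons u v w hadj p ih =>
      rw [SimpleGraph.mulCayley_adj'] at hadj
      rw [SimpleGraph.Walk.length_cons]
      obtain ⟨-, s, hs, h' | h'⟩ := hadj
      · have h2 := (h u s hs).1; rw [h'] at h2; omega
      · have h2 := (h v s hs).2; rw [← h'] at h2; omega
  obtain ⟨p, hp⟩ := (mulCayley_preconnected hS 1 g).exists_walk_length_eq_dist
  have := key p
  rw [wordLength, ← hp]
  omega

theorem exists_mul_eq_wordLength (hS : Subgroup.closure S = ⊤) (g : G) {n : ℕ}
    (hn : n ≤ wordLength S g) :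
    ∃ x y, x * y = g ∧ wordLength S x = n ∧ wordLength S y = wordLength S g - n := by
  obtain ⟨p, hp⟩ := (mulCayley_preconnected hS 1 g).exists_walk_length_eq_dist
  have h1 : wordLength S (p.getVert n) ≤ n := by
    refine (SimpleGraph.dist_le (p.take n)).trans ?_
    rw [SimpleGraph.Walk.take_length]; exact min_le_left _ _
  have h2 : wordLength S ((p.getVert n)⁻¹ * g) ≤ wordLength S g - n := by
    rw [← mulCayley_dist_eq hS]
    refine (SimpleGraph.dist_le (p.drop n)).trans ?_
    rw [SimpleGraph.Walk.drop_length, hp]; rfl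
  have h3 := wordLength_mul_le hS (p.getVert n) ((p.getVert n)⁻¹ * g)
  rw [mul_inv_cancel_left] at h3
  exact ⟨p.getVert n, (p.getVert n)⁻¹ * g, mul_inv_cancel_left _ _, by omega, by omega⟩

theorem eq_one_of_wordLength_eq_zero (hS : Subgroup.closure S = ⊤) {g : G}
    (h : wordLength S g = 0) : g = 1 :=
  ((mulCayley_preconnected hS 1 g).dist_eq_zero_iff.1 h).symm

theorem mem_or_inv_mem_of_wordLength_eq_one {g : G} (h : wordLength S g = 1) :
    g ∈ S ∨ g⁻¹ ∈ S := by
  obtain ⟨-, s, hs, h | h⟩ :=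
    (SimpleGraph.mulCayley_adj' _ _ _).1 (SimpleGraph.dist_eq_one_iff_adj.1 h)
  · left; rwa [← h, one_mul]
  · right; rwa [inv_eq_of_mul_eq_one_right h.symm]

theorem finite_wordLength_le (hS : IsFiniteGeneratingSet S) (n : ℕ) :
    {g : G | wordLength S g ≤ n}.Finite := by
  induction n with
  | zero =>
    refine (Set.finite_singleton (1 : G)).subset fun g hg => ?_
    exact eq_one_of_wordLength_eq_zero hS.2 (Nat.le_zero.1 hg)
  | succ n ih =>
    refine (ih.union (Set.Finite.image2 (fun x y : G => x * y) ih
      (hS.1.union hS.1.inv))).subset fun g hg => ?_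
    rcases Nat.lt_or_ge n (wordLength S g) with h | h
    · have hg' : wordLength S g = n + 1 := le_antisymm hg h
      obtain ⟨x, y, hxy, hx, hy⟩ := exists_mul_eq_wordLength hS.2 g h.le
      refine Or.inr ⟨x, hx.le, y, ?_, hxy⟩
      exact mem_or_inv_mem_of_wordLength_eq_one (by omega)
    · exact Or.inl h

theorem IsFiniteGeneratingSet.countable (hS : IsFiniteGeneratingSet S) : Countable G := by
  rw [← Set.countable_univ_iff]
  refine (Set.countable_iUnion fun n => (finite_wordLength_le hS n).countable).mono ?_
  intro g _
  exact Set.mem_iUnion.2 ⟨wordLength S g, le_refl (wordLength S g)⟩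

end CayleyGraph

/-! ### Decay and tails of Floyd functions. -/

namespace IsFloydFunction

variable {f : ℕ → ℝ}

theorem antitone (hf : IsFloydFunction f) : Antitone f := by
  obtain ⟨lam, -, h⟩ := hf.decay
  refine antitone_nat_of_succ_le fun n => ?_
  rcases Nat.eq_zero_or_pos n with rfl | hn
  · exact hf.zero.ge
  · exact (h n hn).1

theorem exists_pow_mul_le (hf : IsFloydFunction f) :
    ∃ c : ℝ, 0 < c ∧ ∀ k n, c ^ k * f n ≤ f (n + k) := by
  obtain ⟨lam, hlam, h⟩ := hf.decay
  -- The decay bound is given only from `1` on; at `0`, where `f 0 = f 1`, the constant must be at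
  -- most `1`.
  refine ⟨min lam 1, lt_min hlam one_pos, fun k n => ?_⟩
  have step : ∀ n, min lam 1 * f n ≤ f (n + 1) := fun n => by
    rcases Nat.eq_zero_or_pos n with rfl | hn
    · rw [← hf.zero]
      exact mul_le_of_le_one_left (hf.pos 0).le (min_le_right _ _)
    · exact (mul_le_mul_of_nonneg_right (min_le_left _ _) (hf.pos n).le).trans (h n hn).2
  induction k with
  | zero => simp
  | succ k ih =>
    calc min lam 1 ^ (k + 1) * f n = min lam 1 * (min lam 1 ^ k * f n) := by ring
      _ ≤ min lam 1 * f (n + k) := by gcongr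
      _ ≤ f (n + (k + 1)) := step (n + k)

theorem exists_le_mul_add (hf : IsFloydFunction f) (k : ℕ) :
    ∃ C : ℝ≥0, C ≠ 0 ∧ ∀ n, ENNReal.ofReal (f n) ≤ C * ENNReal.ofReal (f (n + k)) := by
  obtain ⟨c, hc, h⟩ := hf.exists_pow_mul_le
  refine ⟨((c ^ k)⁻¹).toNNReal, (Real.toNNReal_pos.2 (by positivity)).ne', fun n => ?_⟩
  change _ ≤ ENNReal.ofReal _ * _
  rw [← ENNReal.ofReal_mul (by positivity)]
  refine ENNReal.ofReal_le_ofReal ?_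
  rw [← div_eq_inv_mul, le_div_iff₀ (by positivity), mul_comm]
  exact h k n

/-- The tail sum of a Floyd function. -/
noncomputable def _root_.floydTail (f : ℕ → ℝ) (n : ℕ) : ℝ≥0∞ :=
  ∑' k, ENNReal.ofReal (f (k + n))

theorem tendsto_floydTail (hf : IsFloydFunction f) : Tendsto (floydTail f) atTop (𝓝 0) :=
  ENNReal.tendsto_sum_nat_add (fun n => ENNReal.ofReal (f n)) hf.summable.tsum_ofReal_ne_top

theorem _root_.floydTail_antitone (f : ℕ → ℝ) : Antitone (floydTail f) := by
  refine antitone_nat_of_succ_le fun n => ?_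
  have h : floydTail f (n + 1) = ∑' k, ENNReal.ofReal (f (k + 1 + n)) := by
    simp only [floydTail, add_comm, add_left_comm]
  rw [h]
  exact ENNReal.tsum_comp_le_tsum_of_injective (add_left_injective 1)
    (fun k => ENNReal.ofReal (f (k + n)))

theorem exists_floydTail_lt (hf : IsFloydFunction f) {ε : ℝ≥0∞} (hε : 0 < ε) :
    ∃ N, floydTail f N < ε :=
  (hf.tendsto_floydTail.eventually (gt_mem_nhds hε)).exists

end IsFloydFunction

/-! ### The Floyd metric: Lipschitz maps, isolated points, total boundedness. -/

section FloydSpace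

variable {G : Type*} [Group G] {S : Set G} {f : ℕ → ℝ}

theorem FloydSpace.edist_def (x y : FloydSpace f S) : edist x y = floydEDist f S x.val y.val := rfl

theorem floydEDist_mul_gen_le {s : G} (hs : s ∈ S) (g : G) :
    floydEDist f S g (g * s) ≤ ENNReal.ofReal (floydEdgeLength f S g (g * s)) := by
  by_cases h : g = g * s
  · rw [← h, floydEDist_self]; exact zero_le
  · refine iInf_le_of_le (SimpleGraph.Walk.cons
      ((SimpleGraph.mulCayley_adj' _ _ _).2 ⟨h, s, hs, Or.inl rfl⟩) SimpleGraph.Walk.nil) ?_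
    simp [floydLength]

theorem floydLength_cons {g h k : G} (e : (SimpleGraph.mulCayley S).Adj g h)
    (p : (SimpleGraph.mulCayley S).Walk h k) :
    floydLength f S (SimpleGraph.Walk.cons e p) = floydEdgeLength f S g h + floydLength f S p := by
  simp [floydLength]

theorem floydEdgeLength_comm (g h : G) :
    floydEdgeLength f S g h = floydEdgeLength f S h g := by
  simp [floydEdgeLength, min_comm]

theorem IsFloydFunction.floydEdgeLength_pos (hf : IsFloydFunction f) (g h : G) :
    0 < floydEdgeLength f S g h := hf.pos _

theorem IsFloydFunction.floydLength_nonneg (hf : IsFloydFunction f) {g h : G}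
    (p : (SimpleGraph.mulCayley S).Walk g h) : 0 ≤ floydLength f S p := by
  refine List.sum_nonneg fun x hx => ?_
  obtain ⟨e, -, rfl⟩ := List.mem_map.1 hx
  exact (hf.floydEdgeLength_pos _ _).le

/-- A map that is Lipschitz along the edges of the Cayley graph is Lipschitz for the Floyd
metric. -/
theorem IsFloydFunction.lipschitzWith (hf : IsFloydFunction f) {E : Type*} [PseudoEMetricSpace E]
    (F : FloydSpace f S → E) {C : ℝ≥0} (hC : C ≠ 0)
    (h : ∀ g, ∀ s ∈ S,
      edist (F ⟨g⟩) (F ⟨g * s⟩) ≤ C * ENNReal.ofReal (floydEdgeLength f S g (g * s))) :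
    LipschitzWith C F := by
  have key : ∀ {u v : G} (p : (SimpleGraph.mulCayley S).Walk u v),
      edist (F ⟨u⟩) (F ⟨v⟩) ≤ C * ENNReal.ofReal (floydLength f S p) := by
    intro u v p
    induction p with
    | nil => simp
    | cons hadj p ih =>
      rw [floydLength_cons, ENNReal.ofReal_add (hf.floydEdgeLength_pos _ _).le
        (hf.floydLength_nonneg p), mul_add]
      refine (edist_triangle _ _ _).trans (add_le_add ?_ ih)
      obtain ⟨-, s, hs, rfl | rfl⟩ := (SimpleGraph.mulCayley_adj' _ _ _).1 hadj
      · exact h _ s hs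
      · rw [edist_comm, floydEdgeLength_comm]; exact h _ s hs
  rintro ⟨x⟩ ⟨y⟩
  rw [FloydSpace.edist_def, floydEDist]
  -- The constant must be nonzero here: the infimum is `⊤` when no path exists.
  rw [ENNReal.mul_iInf_of_ne (by simpa using hC) ENNReal.coe_ne_top]
  exact le_iInf key

/-- The Floyd distance between the end points of a geodesic segment that starts at distance `n`
from `1` and moves away from `1`. -/
theorem floydEDist_mul_le_floydTail (hS : Subgroup.closure S = ⊤) (x u : G)
    (h : wordLength S (x * u) = wordLength S x + wordLength S u) :
    floydEDist f S x (x * u) ≤ floydTail f (wordLength S x) := by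
  have key : ∀ n, ∀ u : G, wordLength S u = n → wordLength S (x * u) = wordLength S x + n →
      floydEDist f S x (x * u) ≤
        ∑ k ∈ Finset.range n, ENNReal.ofReal (f (k + wordLength S x)) := by
    intro n
    induction n with
    | zero =>
      intro u hu _
      rw [eq_one_of_wordLength_eq_zero hS hu, mul_one, floydEDist_self]
      exact zero_le
    | succ n ih =>
      intro u hu hxu
      obtain ⟨v, s, rfl, hv, hs⟩ := exists_mul_eq_wordLength hS u (n := n) (by omega)
      have h1 := wordLength_mul_le hS (x * v) s
      have h2 := wordLength_mul_le hS x v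
      rw [← mul_assoc] at hxu ⊢
      have hxv : wordLength S (x * v) = wordLength S x + n := by omega
      rw [Finset.sum_range_succ]
      refine (floydEDist_triangle _ _ _ (x * v) _).trans (add_le_add (ih v hv hxv) ?_)
      have hm : floydEdgeLength f S (x * v) (x * v * s) = f (n + wordLength S x) := by
        rw [floydEdgeLength, hxv, hxu, min_eq_left (by omega), add_comm]
      rw [← hm]
      rcases mem_or_inv_mem_of_wordLength_eq_one (S := S) (g := s) (by omega) with h3 | h3
      · exact floydEDist_mul_gen_le h3 _
      · rw [floydEDist_comm, floydEdgeLength_comm]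
        simpa using floydEDist_mul_gen_le (f := f) h3 (x * v * s)
  exact (key _ u rfl h).trans (ENNReal.sum_le_tsum _)

/-- A path leaving `x` starts with an edge at `x`, whose Floyd length is already at least the bound.
Hence group elements are isolated. -/
theorem IsFloydFunction.eq_of_edist_lt (hf : IsFloydFunction f) (x y : FloydSpace f S)
    (h : edist x y < ENNReal.ofReal (f (wordLength S x.val))) : y = x := by
  by_contra hne
  refine absurd h (not_lt.2 ?_)
  rw [FloydSpace.edist_def, floydEDist]
  refine le_iInf fun p => ENNReal.ofReal_le_ofReal ?_
  obtain ⟨x⟩ := x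
  obtain ⟨y⟩ := y
  cases p with
  | nil => exact absurd rfl hne
  | @cons _ v _ e p =>
    rw [floydLength_cons]
    have := hf.floydLength_nonneg p
    have h2 : f (wordLength S x) ≤ floydEdgeLength f S x v := hf.antitone (min_le_left _ _)
    linarith

/-- Isolation of `x` phrased through the uniformity, so that it pulls back along uniformly
continuous maps. -/
theorem IsFloydFunction.eventually_uniformity_eq (hf : IsFloydFunction f) (x : FloydSpace f S) :
    ∀ᶠ p : FloydSpace f S × FloydSpace f S in 𝓤 (FloydSpace f S), p.1 = x → p.2 = x := by
  refine mem_of_superset (edist_mem_uniformity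
    (ENNReal.ofReal_pos.2 (hf.pos (wordLength S x.val)))) ?_
  rintro ⟨y, z⟩ h rfl
  exact hf.eq_of_edist_lt _ _ h

/-- A geodesic from `1` to a far point crosses the sphere of radius `N`, and the rest of it is no
longer than a tail of the series; balls of the word metric are finite. -/
theorem IsFloydFunction.totallyBounded (hf : IsFloydFunction f) (hS : IsFiniteGeneratingSet S) :
    TotallyBounded (Set.univ : Set (FloydSpace f S)) := by
  rw [EMetric.totallyBounded_iff]
  intro ε hε
  obtain ⟨N, hN⟩ := hf.exists_floydTail_lt hε
  refine ⟨FloydSpace.mk '' {g | wordLength S g ≤ N}, (finite_wordLength_le hS N).image _, ?_⟩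
  rintro ⟨y⟩ -
  simp only [Set.mem_iUnion, Set.mem_image, exists_prop]
  rcases le_total (wordLength S y) N with h | h
  · exact ⟨⟨y⟩, ⟨y, h, rfl⟩, by simpa using hε⟩
  · obtain ⟨x, u, rfl, hx, hu⟩ := exists_mul_eq_wordLength hS.2 y h
    refine ⟨⟨x⟩, ⟨x, hx.le, rfl⟩, ?_⟩
    rw [Metric.mem_eball, edist_comm]
    refine (floydEDist_mul_le_floydTail hS.2 x u (by omega)).trans_lt ?_
    rwa [hx]

end FloydSpace

/-! ### From uniform equivalences to homeomorphisms of boundaries. -/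

section Boundary

variable {G H : Type*} [Group G] [Group H] {S : Set G} {T : Set H} {f f' : ℕ → ℝ}

theorem FloydBoundary.nonempty_homeomorph (e : FloydSpace f S ≃ᵤ FloydSpace f' T) :
    Nonempty (FloydBoundary f S ≃ₜ FloydBoundary f' T) := by
  refine ⟨(UniformSpace.Completion.mapEquiv e).toHomeomorph.subtype fun x => ?_⟩
  refine not_congr ⟨?_, ?_⟩
  · rintro ⟨y, rfl⟩
    exact ⟨e y, (UniformSpace.Completion.mapEquiv_coe e y).symm⟩
  · rintro ⟨y, hy⟩
    refine ⟨e.symm y, ?_⟩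
    apply (UniformSpace.Completion.mapEquiv e).injective
    rw [UniformSpace.Completion.mapEquiv_coe]
    rw [e.apply_symm_apply]
    exact hy

end Boundary

/-! ### Compactifications by isolated points are determined by their remainders. -/

section Compactification

variable {X Y K L : Type*} [MetricSpace K] [MetricSpace L]

theorem finite_of_isCompact_of_isOpen_singleton {K : Type*} [TopologicalSpace K] {s : Set K}
    (hs : IsCompact s) (h : ∀ z ∈ s, IsOpen {z}) : s.Finite := by
  obtain ⟨t, -, ht⟩ := hs.elim_nhds_subcover (fun z => {z}) fun z hz => (h z hz).mem_nhds rfl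
  exact t.finite_toSet.subset fun z hz => by simpa using ht hz

theorem isClosed_compl_range {i : X → K} (hi : ∀ x, IsOpen {i x}) :
    IsClosed (Set.range i)ᶜ := by
  rw [isClosed_compl_iff, ← Set.iUnion_singleton_eq_range]
  exact isOpen_iUnion hi

theorem nonempty_compl_range [CompactSpace K] [Infinite X] {i : X → K} (hinj : Function.Injective i)
    (hi : ∀ x, IsOpen {i x}) : (Set.range i)ᶜ.Nonempty := by
  by_contra hne
  rw [Set.not_nonempty_iff_eq_empty, Set.compl_empty_iff] at hne
  have h : (Set.univ : Set K).Finite := by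
    refine finite_of_isCompact_of_isOpen_singleton isCompact_univ fun z _ => ?_
    obtain ⟨x, rfl⟩ : z ∈ Set.range i := hne ▸ Set.mem_univ z
    exact hi x
  rw [← hne] at h
  exact Set.infinite_range_of_injective hinj h

theorem le_cofinite_of_tendsto {i : X → K} {z : K}
    (hz : z ∉ Set.range i) {l : Filter X} (hl : Tendsto i l (𝓝 z)) : l ≤ cofinite := by
  rw [le_cofinite_iff_eventually_ne]
  intro x
  have hx : z ≠ i x := fun h => hz ⟨x, h.symm⟩
  filter_upwards [hl.eventually_ne hx] with y hy h
  exact hy (congrArg i h)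

/-- A nearest point projection to the remainder of a compactification. -/
theorem exists_tendsto_dist_cofinite [CompactSpace K] [Infinite X] {i : X → K} (hinj : Function.Injective i)
    (hi : ∀ x, IsOpen {i x}) :
    ∃ p : X → {z // z ∉ Set.range i},
      Tendsto (fun x => dist (i x) (p x : K)) cofinite (𝓝 0) := by
  have hne := nonempty_compl_range hinj hi
  have h := fun x => (isClosed_compl_range hi).isCompact.exists_infDist_eq_dist hne (i x)
  choose p hp hpd using h
  refine ⟨fun x => ⟨p x, hp x⟩, ?_⟩
  rw [Metric.tendsto_nhds]
  intro ε hε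
  rw [eventually_cofinite]
  -- A compact set that misses the remainder consists of isolated points, so it is finite.
  have hfin : {z : K | ε ≤ Metric.infDist z (Set.range i)ᶜ}.Finite := by
    refine finite_of_isCompact_of_isOpen_singleton
      (isClosed_le continuous_const (Metric.continuous_infDist_pt _)).isCompact fun z hz => ?_
    by_cases h : z ∈ Set.range i
    · obtain ⟨x, rfl⟩ := h
      exact hi x
    · have h0 : Metric.infDist z (Set.range i)ᶜ = 0 := Metric.infDist_zero_of_mem h
      have hz' : ε ≤ Metric.infDist z (Set.range i)ᶜ := hz
      linarith
  refine (hfin.preimage hinj.injOn).subset fun x hx => ?_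
  have hx' : ¬ dist (dist (i x) (p x)) 0 < ε := hx
  rw [Real.dist_0_eq_abs, abs_of_nonneg dist_nonneg, ← hpd, not_lt] at hx'
  exact hx'

theorem infinite_dist_lt {j : Y → L} (hd : DenseRange j) {z : L} (hz : z ∉ Set.range j)
    {ε : ℝ} (hε : 0 < ε) : {y | dist (j y) z < ε}.Infinite := by
  intro hfin
  have ho : IsOpen (Metric.ball z ε \ (j '' {y | dist (j y) z < ε})) :=
    Metric.isOpen_ball.sdiff (hfin.image j).isClosed
  obtain ⟨y, hy1, hy2⟩ := hd.exists_mem_open ho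
    ⟨z, Metric.mem_ball_self hε, fun ⟨y, _, hy⟩ => hz ⟨y, hy⟩⟩
  exact hy2 ⟨y, hy1, rfl⟩

/-- Hall's marriage theorem with `e x + 1` candidates for `x`: in a finite set of points, the one
with the largest `e` alone has enough candidates for all. -/
theorem exists_injective_mem_of_infinite {e : X → ℕ} (he : Function.Injective e)
    (s : X → Set Y) (hs : ∀ x, (s x).Infinite) :
    ∃ F : X → Y, Function.Injective F ∧ ∀ x, F x ∈ s x := by
  classical
  choose t hts htc using fun x => (hs x).exists_subset_card_eq (e x + 1)
  obtain ⟨F, hF, hFt⟩ := (Finset.all_card_le_biUnion_card_iff_exists_injective t).1 fun A => by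
    rcases A.eq_empty_or_nonempty with rfl | hA
    · simp
    obtain ⟨x, hx, hmax⟩ := A.exists_max_image e hA
    calc A.card = (A.image e).card := (Finset.card_image_of_injective _ he).symm
      _ ≤ (Finset.range (e x + 1)).card := Finset.card_le_card fun n hn => by
        obtain ⟨y, hy, rfl⟩ := Finset.mem_image.1 hn
        exact Finset.mem_range_succ_iff.2 (hmax y hy)
      _ = (t x).card := by rw [Finset.card_range, htc]
      _ ≤ _ := Finset.card_le_card (Finset.subset_biUnion_of_mem t hx)
  exact ⟨F, hF, fun x => hts x (hFt x)⟩

/-- The filter is split according to which alternative of `hR` holds. In the first, `φ x` follows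
the image under `h` of the projection of `x`; in the second, `x` follows the image under `h.symm` of
the projection of `φ x`, and applying `h` gives the same limit. -/
theorem tendsto_of_dist_lt_or {i : X → K} {j : Y → L}
    {p : X → {z // z ∉ Set.range i}} {q : Y → {z // z ∉ Set.range j}}
    (hp : Tendsto (fun x => dist (i x) (p x : K)) cofinite (𝓝 0))
    (hq : Tendsto (fun y => dist (j y) (q y : L)) cofinite (𝓝 0))
    (h : {z // z ∉ Set.range i} ≃ₜ {z // z ∉ Set.range j}) {a : X → ℝ} {b : Y → ℝ}
    (ha : Tendsto a cofinite (𝓝 0)) (hb : Tendsto b cofinite (𝓝 0)) {φ : X → Y}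
    (hφ : Function.Injective φ)
    (hR : ∀ x, dist (j (φ x)) (h (p x) : L) < a x ∨ dist (i x) (h.symm (q (φ x)) : K) < b (φ x))
    (z : {z // z ∉ Set.range i}) {l : Filter X} (hl : Tendsto i l (𝓝 (z : K))) :
    Tendsto (fun x => j (φ x)) l (𝓝 (h z : L)) := by
  have key1 : ∀ l : Filter X, Tendsto i l (𝓝 (z : K)) →
      (∀ᶠ x in l, dist (j (φ x)) (h (p x) : L) < a x) →
      Tendsto (fun x => j (φ x)) l (𝓝 (h z : L)) := by
    intro l hl h1
    have hc := le_cofinite_of_tendsto z.2 hl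
    have h2 : Tendsto p l (𝓝 z) := tendsto_subtype_rng.2 (hl.congr_dist (hp.mono_left hc))
    have h3 := tendsto_subtype_rng.1 ((h.continuous.tendsto z).comp h2)
    refine h3.congr_dist (squeeze_zero' (Eventually.of_forall fun _ => dist_nonneg) ?_
      (ha.mono_left hc))
    filter_upwards [h1] with x hx
    rw [dist_comm]
    exact hx.le
  have key2 : ∀ l : Filter X, Tendsto i l (𝓝 (z : K)) →
      (∀ᶠ x in l, dist (i x) (h.symm (q (φ x)) : K) < b (φ x)) →
      Tendsto (fun x => j (φ x)) l (𝓝 (h z : L)) := by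
    intro l hl h1
    have hc := le_cofinite_of_tendsto z.2 hl
    have hφc : Tendsto φ l cofinite := hφ.tendsto_cofinite.mono_left hc
    have h2 : Tendsto (fun x => h.symm (q (φ x))) l (𝓝 z) := by
      refine tendsto_subtype_rng.2 (hl.congr_dist
        (squeeze_zero' (Eventually.of_forall fun _ => dist_nonneg) ?_ (hb.comp hφc)))
      filter_upwards [h1] with x hx using hx.le
    have h3 := tendsto_subtype_rng.1 ((h.continuous.tendsto z).comp h2)
    simp only [Function.comp_def, Homeomorph.apply_symm_apply] at h3
    refine h3.congr_dist ?_
    simpa only [dist_comm, Function.comp_def] using hq.comp hφc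
  have hsplit : l = l ⊓ 𝓟 {x | dist (j (φ x)) (h (p x) : L) < a x} ⊔
      l ⊓ 𝓟 {x | dist (j (φ x)) (h (p x) : L) < a x}ᶜ := by
    rw [← inf_sup_left, sup_principal, Set.union_compl_self, principal_univ, inf_top_eq]
  rw [hsplit]
  refine Tendsto.sup (key1 _ (hl.mono_left inf_le_left) (mem_inf_of_right (mem_principal_self _)))
    (key2 _ (hl.mono_left inf_le_left) ?_)
  filter_upwards [mem_inf_of_right (mem_principal_self _)] with x hx
  exact (hR x).resolve_left hx

theorem exists_equiv_tendsto [CompactSpace K] [CompactSpace L] [Countable X] [Infinite X] [Countable Y] [Infinite Y]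
    {i : X → K} {j : Y → L} (hiinj : Function.Injective i) (hjinj : Function.Injective j)
    (hi : ∀ x, IsOpen {i x}) (hj : ∀ y, IsOpen {j y}) (hid : DenseRange i) (hjd : DenseRange j)
    (h : {z // z ∉ Set.range i} ≃ₜ {z // z ∉ Set.range j}) :
    ∃ φ : X ≃ Y,
      (∀ (z : {z // z ∉ Set.range i}) (l : Filter X), Tendsto i l (𝓝 (z : K)) →
        Tendsto (fun x => j (φ x)) l (𝓝 (h z : L))) ∧
      (∀ (z : {z // z ∉ Set.range j}) (l : Filter Y), Tendsto j l (𝓝 (z : L)) →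
        Tendsto (fun y => i (φ.symm y)) l (𝓝 (h.symm z : K))) := by
  obtain ⟨p, hp⟩ := exists_tendsto_dist_cofinite hiinj hi
  obtain ⟨q, hq⟩ := exists_tendsto_dist_cofinite hjinj hj
  obtain ⟨a, ha⟩ := exists_injective_nat X
  obtain ⟨b, hb⟩ := exists_injective_nat Y
  have hlim : Tendsto (fun n : ℕ => 1 / ((n : ℝ) + 1)) cofinite (𝓝 0) := by
    rw [Nat.cofinite_eq_atTop]; exact tendsto_one_div_add_atTop_nhds_zero_nat
  have ha' := hlim.comp ha.tendsto_cofinite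
  have hb' := hlim.comp hb.tendsto_cofinite
  obtain ⟨F, hF, hFd⟩ := exists_injective_mem_of_infinite ha
    (fun x => {y | dist (j y) (h (p x) : L) < 1 / ((a x : ℝ) + 1)})
    fun x => infinite_dist_lt hjd (h (p x)).2 (by positivity)
  obtain ⟨F', hF', hFd'⟩ := exists_injective_mem_of_infinite hb
    (fun y => {x | dist (i x) (h.symm (q y) : K) < 1 / ((b y : ℝ) + 1)})
    fun y => infinite_dist_lt hid (h.symm (q y)).2 (by positivity)
  -- The bijection uses only pairs from `F` or from `F'`, so each pair inherits one of the two
  -- closeness estimates.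
  obtain ⟨φ, hφ, hR⟩ := Function.Embedding.schroeder_bernstein_of_rel hF hF'
    (fun x y => dist (j y) (h (p x) : L) < 1 / ((a x : ℝ) + 1) ∨
      dist (i x) (h.symm (q y) : K) < 1 / ((b y : ℝ) + 1))
    (fun x => Or.inl (hFd x)) (fun y => Or.inr (hFd' y))
  refine ⟨Equiv.ofBijective φ hφ, fun z l hl => ?_, fun z l hl => ?_⟩
  · exact tendsto_of_dist_lt_or hp hq h ha' hb' hφ.1 hR z hl
  · refine tendsto_of_dist_lt_or hq hp h.symm hb' ha'
      (Equiv.ofBijective φ hφ).symm.injective (fun y => ?_) z hl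
    obtain ⟨x, rfl⟩ := hφ.2 y
    have hx : (Equiv.ofBijective φ hφ).symm (φ x) = x :=
      (Equiv.ofBijective φ hφ).symm_apply_apply x
    rw [hx]
    exact (hR x).symm

end Compactification

/-! ### Completions of totally bounded uniform spaces of isolated points. -/

section Completion

variable {X Y : Type*} [UniformSpace X] [UniformSpace Y]

theorem UniformSpace.Completion.isCountablyGenerated_uniformity [IsCountablyGenerated (𝓤 X)] :
    IsCountablyGenerated (𝓤 (Completion X)) := by
  let := UniformSpace.pseudoMetricSpace X
  exact EMetric.instIsCountablyGeneratedUniformity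

theorem UniformSpace.Completion.compactSpace_of_totallyBounded
    (hX : TotallyBounded (Set.univ : Set X)) : CompactSpace (Completion X) := by
  have h := (hX.image (uniformContinuous_coe X)).closure
  rw [Set.image_univ, denseRange_coe.closure_range] at h
  exact ⟨h.isCompact_of_isClosed isClosed_univ⟩

theorem nhds_eq_pure_of_eventually_uniformity {x : X} (hx : ∀ᶠ p in 𝓤 X, p.1 = x → p.2 = x) :
    𝓝 x = pure x :=
  le_antisymm (le_pure_iff.2 (mem_nhds_uniformity_iff_right.2 hx)) (pure_le_nhds x)

/-- Some open neighbourhood of `x` contains no other point of `X`; removing `x` from it leaves an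
open set that misses a dense set, hence is empty. -/
theorem UniformSpace.Completion.isOpen_singleton_coe {x : X}
    (hx : ∀ᶠ p in 𝓤 X, p.1 = x → p.2 = x) : IsOpen {(x : Completion X)} := by
  have h : ({x} : Set X) ∈ Filter.comap ((↑) : X → Completion X) (𝓝 (x : Completion X)) := by
    rw [← isDenseInducing_coe.nhds_eq_comap, nhds_eq_pure_of_eventually_uniformity hx]
    exact mem_pure.2 rfl
  obtain ⟨W, hW, hWx⟩ := mem_comap.1 h
  obtain ⟨V, hVW, hV, hxV⟩ := _root_.mem_nhds_iff.1 hW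
  convert hV
  refine (Set.singleton_subset_iff.2 hxV).antisymm fun z hz => ?_
  by_contra hne
  obtain ⟨y, hyV, hy⟩ := denseRange_coe.exists_mem_open
    (hV.sdiff (isClosed_singleton (x := (x : Completion X)))) ⟨z, hz, hne⟩
  exact hy (congrArg _ (hWx (hVW hyV)))

theorem UniformSpace.Completion.coe_injective_of_eventually
    (hX : ∀ x : X, ∀ᶠ p in 𝓤 X, p.1 = x → p.2 = x) :
    Function.Injective ((↑) : X → Completion X) := by
  intro x y hxy
  have h : 𝓝 x = 𝓝 y := by
    rw [isDenseInducing_coe.nhds_eq_comap x, isDenseInducing_coe.nhds_eq_comap y, hxy]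
  rw [nhds_eq_pure_of_eventually_uniformity (hX x),
    nhds_eq_pure_of_eventually_uniformity (hX y)] at h
  exact pure_injective h

/-- Limits exist at boundary points by `h` and at points of `X` by isolation, so `φ` extends
continuously to the compact completion, where continuity is uniform. -/
theorem uniformContinuous_of_tendsto_boundary (hX : TotallyBounded (Set.univ : Set X))
    (hX' : ∀ x : X, ∀ᶠ p in 𝓤 X, p.1 = x → p.2 = x) (φ : X → Y)
    (h : ∀ z : UniformSpace.Completion X, z ∉ Set.range ((↑) : X → UniformSpace.Completion X) →
      ∃ c : UniformSpace.Completion Y, ∀ l : Filter X,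
        Tendsto ((↑) : X → UniformSpace.Completion X) l (𝓝 z) →
        Tendsto (fun x => (φ x : UniformSpace.Completion Y)) l (𝓝 c)) :
    UniformContinuous φ := by
  have hc := UniformSpace.Completion.compactSpace_of_totallyBounded hX
  have di := UniformSpace.Completion.isDenseInducing_coe (α := X)
  have hpt : ∀ x : X, Tendsto (fun x => (φ x : UniformSpace.Completion Y))
      (comap ((↑) : X → UniformSpace.Completion X) (𝓝 x)) (𝓝 (φ x)) := by
    intro x
    rw [← di.nhds_eq_comap, nhds_eq_pure_of_eventually_uniformity (hX' x)]
    exact tendsto_pure_nhds _ _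
  have hcont : Continuous (di.extend fun x => (φ x : UniformSpace.Completion Y)) := by
    refine di.continuous_extend fun z => ?_
    by_cases hz : z ∈ Set.range ((↑) : X → UniformSpace.Completion X)
    · obtain ⟨x, rfl⟩ := hz
      exact ⟨_, hpt x⟩
    · obtain ⟨c, hc⟩ := h z hz
      exact ⟨c, hc _ tendsto_comap⟩
  have hu := (CompactSpace.uniformContinuous_of_continuous hcont).comp
    (UniformSpace.Completion.uniformContinuous_coe X)
  refine (UniformSpace.Completion.isUniformInducing_coe Y).uniformContinuous_iff.2 ?_
  convert hu using 1
  funext x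
  exact (di.extend_eq_of_tendsto (hpt x)).symm

theorem exists_uniformEquiv [IsCountablyGenerated (𝓤 X)] [IsCountablyGenerated (𝓤 Y)]
    [Countable X] [Infinite X] [Countable Y] [Infinite Y]
    (hX : TotallyBounded (Set.univ : Set X)) (hY : TotallyBounded (Set.univ : Set Y))
    (hX' : ∀ x : X, ∀ᶠ p in 𝓤 X, p.1 = x → p.2 = x)
    (hY' : ∀ y : Y, ∀ᶠ p in 𝓤 Y, p.1 = y → p.2 = y)
    (h : {z : UniformSpace.Completion X //
        z ∉ Set.range ((↑) : X → UniformSpace.Completion X)} ≃ₜ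
      {z : UniformSpace.Completion Y //
        z ∉ Set.range ((↑) : Y → UniformSpace.Completion Y)}) :
    Nonempty (X ≃ᵤ Y) := by
  have := UniformSpace.Completion.isCountablyGenerated_uniformity (X := X)
  have := UniformSpace.Completion.isCountablyGenerated_uniformity (X := Y)
  let := UniformSpace.metricSpace (UniformSpace.Completion X)
  let := UniformSpace.metricSpace (UniformSpace.Completion Y)
  have := UniformSpace.Completion.compactSpace_of_totallyBounded hX
  have := UniformSpace.Completion.compactSpace_of_totallyBounded hY
  obtain ⟨φ, h1, h2⟩ := exists_equiv_tendsto
    (UniformSpace.Completion.coe_injective_of_eventually hX')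
    (UniformSpace.Completion.coe_injective_of_eventually hY')
    (fun x => UniformSpace.Completion.isOpen_singleton_coe (hX' x))
    (fun y => UniformSpace.Completion.isOpen_singleton_coe (hY' y))
    UniformSpace.Completion.denseRange_coe UniformSpace.Completion.denseRange_coe h
  exact ⟨⟨φ, uniformContinuous_of_tendsto_boundary hX hX' φ fun z hz => ⟨_, h1 ⟨z, hz⟩⟩,
    uniformContinuous_of_tendsto_boundary hY hY' φ.symm fun z hz => ⟨_, h2 ⟨z, hz⟩⟩⟩⟩

/-- The swap of two isolated points is a uniform equivalence. -/
theorem uniformContinuous_equiv_swap [DecidableEq X] {a b : X}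
    (ha : ∀ᶠ p in 𝓤 X, p.1 = a → p.2 = a) (hb : ∀ᶠ p in 𝓤 X, p.1 = b → p.2 = b) :
    UniformContinuous (Equiv.swap a b) := by
  have ha' := tendsto_swap_uniformity.eventually ha
  have hb' := tendsto_swap_uniformity.eventually hb
  intro V hV
  refine mem_map.2 ?_
  filter_upwards [ha, hb, ha', hb', hV] with p h1 h2 h3 h4 h5
  have hrefl : ∀ x : X, (x, x) ∈ V := fun x => refl_mem_uniformity hV
  obtain ⟨x, y⟩ := p
  simp only [Prod.fst_swap, Prod.snd_swap] at h1 h2 h3 h4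
  simp only [Set.mem_preimage]
  by_cases hxa : x = a
  · rw [hxa, h1 hxa]; exact hrefl _
  by_cases hxb : x = b
  · rw [hxb, h2 hxb]; exact hrefl _
  rw [Equiv.swap_apply_of_ne_of_ne hxa hxb,
    Equiv.swap_apply_of_ne_of_ne (fun h => hxa (h3 h)) (fun h => hxb (h4 h))]
  exact h5

/-- Serves to make equivalences of the factors fix `1`, so that they send reduced words to reduced
words. -/
theorem UniformEquiv.exists_apply_eq (e : X ≃ᵤ Y) (x : X) (y : Y)
    (hY : ∀ y : Y, ∀ᶠ p in 𝓤 Y, p.1 = y → p.2 = y) : ∃ e' : X ≃ᵤ Y, e' x = y := by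
  classical
  let s : Y ≃ᵤ Y := ⟨Equiv.swap (e x) y, uniformContinuous_equiv_swap (hY _) (hY _),
    uniformContinuous_equiv_swap (hY _) (hY _)⟩
  exact ⟨e.trans s, Equiv.swap_apply_left _ _⟩

end Completion

/-! ### Recovering the based Floyd space from its boundary. -/

section FloydBoundary

variable {G H : Type*} [Group G] [Group H] {S : Set G} {T : Set H} {f f' : ℕ → ℝ}

/-- The Floyd boundary determines the Floyd compactification of an infinite group, as a uniform
space together with the base point. -/
theorem FloydSpace.exists_uniformEquiv_of_boundary [Infinite G] [Infinite H]
    (hf : IsFloydFunction f) (hf' : IsFloydFunction f') (hS : IsFiniteGeneratingSet S)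
    (hT : IsFiniteGeneratingSet T) (h : FloydBoundary f S ≃ₜ FloydBoundary f' T) :
    ∃ e : FloydSpace f S ≃ᵤ FloydSpace f' T, e ⟨1⟩ = ⟨1⟩ := by
  let eG : G ≃ FloydSpace f S := ⟨FloydSpace.mk, FloydSpace.val, fun _ => rfl, fun _ => rfl⟩
  let eH : H ≃ FloydSpace f' T := ⟨FloydSpace.mk, FloydSpace.val, fun _ => rfl, fun _ => rfl⟩
  have := hS.countable
  have := hT.countable
  have := eG.symm.injective.countable
  have := eH.symm.injective.countable
  have := eG.infinite_iff.1 inferInstance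
  have := eH.infinite_iff.1 inferInstance
  obtain ⟨e⟩ := exists_uniformEquiv (hf.totallyBounded hS) (hf'.totallyBounded hT)
    hf.eventually_uniformity_eq hf'.eventually_uniformity_eq h
  exact e.exists_apply_eq ⟨1⟩ ⟨1⟩ hf'.eventually_uniformity_eq

end FloydBoundary

/-! ### Change of generating set, and group isomorphisms. -/

section GeneratingSets

variable {G H : Type*} [Group G] [Group H] {S T : Set G} {f : ℕ → ℝ}

theorem wordLength_le_mul_wordLength (hS : Subgroup.closure S = ⊤) (hT : Subgroup.closure T = ⊤)
    {K : ℕ} (hK : ∀ t ∈ T, wordLength S t ≤ K) (g : G) :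
    wordLength S g ≤ K * wordLength T g := by
  have key : ∀ n, ∀ g : G, wordLength T g = n → wordLength S g ≤ K * n := by
    intro n
    induction n with
    | zero => intro g hg; rw [eq_one_of_wordLength_eq_zero hT hg, wordLength_one, mul_zero]
    | succ n ih =>
      intro g hg
      obtain ⟨x, t, rfl, hx, ht⟩ := exists_mul_eq_wordLength hT g (n := n) (by omega)
      have h1 : wordLength S t ≤ K := by
        rcases mem_or_inv_mem_of_wordLength_eq_one (S := T) (g := t) (by omega) with h | h
        · exact hK t h
        · rw [← wordLength_inv hS]; exact hK _ h
      calc wordLength S (x * t) ≤ wordLength S x + wordLength S t := wordLength_mul_le hS _ _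
        _ ≤ K * n + K := add_le_add (ih x hx) h1
        _ = K * (n + 1) := by ring
  exact key _ g rfl

theorem exists_wordLength_le_of_finite (hT : T.Finite) : ∃ K, ∀ t ∈ T, wordLength S t ≤ K := by
  obtain ⟨K, hK⟩ := (hT.image (wordLength S)).bddAbove
  exact ⟨K, fun t ht => hK ⟨t, ht, rfl⟩⟩

/-- A translated geodesic for `u` has `wordLength T u` edges, none nearer to `1` than the
(truncated) difference of the lengths. -/
theorem IsFloydFunction.floydEDist_mul_le (hf : IsFloydFunction f)
    (hT : Subgroup.closure T = ⊤) (g u : G) :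
    floydEDist f T g (g * u) ≤
      wordLength T u * ENNReal.ofReal (f (wordLength T g - wordLength T u)) := by
  have key : ∀ n, ∀ u : G, wordLength T u = n →
      floydEDist f T g (g * u) ≤ n * ENNReal.ofReal (f (wordLength T g - n)) := by
    intro n
    induction n with
    | zero =>
      intro u hu
      rw [eq_one_of_wordLength_eq_zero hT hu, mul_one, floydEDist_self]
      exact zero_le
    | succ n ih =>
      intro u hu
      obtain ⟨v, t, rfl, hv, ht⟩ := exists_mul_eq_wordLength hT u (n := n) (by omega)
      have hlow : ∀ w : G, wordLength T g ≤ wordLength T (g * w) + wordLength T w := fun w => by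
        have := wordLength_mul_le hT (g * w) w⁻¹
        rwa [mul_inv_cancel_right, wordLength_inv hT] at this
      have h1 := hlow v
      have h2 := hlow (v * t)
      rw [← mul_assoc] at h2 ⊢
      have hle : floydEdgeLength f T (g * v) (g * v * t) ≤ f (wordLength T g - (n + 1)) :=
        hf.antitone (le_min (by omega) (by omega))
      have hstep : floydEDist f T (g * v) (g * v * t) ≤
          ENNReal.ofReal (f (wordLength T g - (n + 1))) := by
        refine le_trans ?_ (ENNReal.ofReal_le_ofReal hle)
        rcases mem_or_inv_mem_of_wordLength_eq_one (S := T) (g := t) (by omega) with h3 | h3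
        · exact floydEDist_mul_gen_le h3 _
        · rw [floydEDist_comm, floydEdgeLength_comm]
          simpa using floydEDist_mul_gen_le (f := f) h3 (g * v * t)
      have hmono : ENNReal.ofReal (f (wordLength T g - n)) ≤
          ENNReal.ofReal (f (wordLength T g - (n + 1))) :=
        ENNReal.ofReal_le_ofReal (hf.antitone (by omega))
      calc floydEDist f T g (g * v * t) ≤ _ := floydEDist_triangle _ _ _ (g * v) _
        _ ≤ n * ENNReal.ofReal (f (wordLength T g - (n + 1))) +
            ENNReal.ofReal (f (wordLength T g - (n + 1))) :=
          add_le_add ((ih v hv).trans (by gcongr)) hstep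
        _ = _ := by push_cast; ring
  exact key _ u rfl

theorem IsFloydFunction.exists_le_mul_mul (hf : IsFloydFunction f)
    (hD : ∃ D : ℝ, ∀ n, f n ≤ D * f (2 * n)) (K : ℕ) :
    ∃ C : ℝ≥0, ∀ n, ENNReal.ofReal (f n) ≤ C * ENNReal.ofReal (f (K * n)) := by
  obtain ⟨D, hD⟩ := hD
  have hD0 : 0 < D := by
    have := (hf.pos 0).trans_le (hD 0)
    exact pos_of_mul_pos_left this (hf.pos _).le
  have hpow : ∀ j n, f n ≤ D ^ j * f (2 ^ j * n) := by
    intro j n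
    induction j with
    | zero => simp
    | succ j ih =>
      calc f n ≤ D ^ j * f (2 ^ j * n) := ih
        _ ≤ D ^ j * (D * f (2 * (2 ^ j * n))) := by gcongr; exact hD _
        _ = D ^ (j + 1) * f (2 ^ (j + 1) * n) := by
          rw [pow_succ 2 j, mul_comm (2 ^ j) 2, mul_assoc 2, ← mul_assoc, ← pow_succ]
  -- Doubling `K` times suffices since `K ≤ 2 ^ K` and `f` is antitone.
  refine ⟨(D ^ K).toNNReal, fun n => ?_⟩
  change _ ≤ ENNReal.ofReal _ * _
  rw [← ENNReal.ofReal_mul (by positivity)]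
  refine ENNReal.ofReal_le_ofReal ((hpow K n).trans ?_)
  gcongr
  exact hf.antitone (Nat.mul_le_mul_right n Nat.lt_two_pow_self.le)

theorem IsFloydFunction.uniformContinuous_change_generators (hf : IsFloydFunction f)
    (hD : ∃ D : ℝ, ∀ n, f n ≤ D * f (2 * n)) (hS : IsFiniteGeneratingSet S)
    (hT : IsFiniteGeneratingSet T) :
    UniformContinuous fun x : FloydSpace f S => (⟨x.val⟩ : FloydSpace f T) := by
  obtain ⟨k, hk⟩ := exists_wordLength_le_of_finite (S := T) hS.1
  obtain ⟨K, hK⟩ := exists_wordLength_le_of_finite (S := S) hT.1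
  obtain ⟨C, hC, hCf⟩ := hf.exists_le_mul_add k
  obtain ⟨C', hC'f⟩ := hf.exists_le_mul_mul hD K
  -- An `S`-edge becomes a `T`-path of at most `k` edges; `C` pays for its approach to `1` by at
  -- most `k`, `C'` for the comparison of the two word lengths. The summand `1` only keeps the
  -- constant nonzero.
  refine (hf.lipschitzWith (C := k * (C * C') + 1) _ (by positivity)
    fun g s hs => ?_).uniformContinuous
  rw [FloydSpace.edist_def]
  have h0 : floydEDist f T g (g * s) ≤ k * ENNReal.ofReal (f (wordLength T g - k)) := by
    refine (hf.floydEDist_mul_le hT.2 g s).trans ?_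
    have h1 := hk s hs
    refine mul_le_mul' (by exact_mod_cast h1) (ENNReal.ofReal_le_ofReal (hf.antitone (by omega)))
  have h1 : ENNReal.ofReal (f (wordLength T g - k)) ≤ C * ENNReal.ofReal (f (wordLength T g)) := by
    refine (hCf _).trans ?_
    gcongr
    exact hf.antitone (by omega)
  have h2 : ENNReal.ofReal (f (wordLength T g)) ≤
      C' * ENNReal.ofReal (floydEdgeLength f S g (g * s)) := by
    refine (hC'f _).trans ?_
    gcongr
    exact hf.antitone ((min_le_left _ _).trans (wordLength_le_mul_wordLength hS.2 hT.2 hK g))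
  calc floydEDist f T g (g * s)
      ≤ k * (C * (C' * ENNReal.ofReal (floydEdgeLength f S g (g * s)))) := by
        refine h0.trans ?_
        gcongr
        exact h1.trans (by gcongr)
    _ = ((k * (C * C') : ℝ≥0) : ℝ≥0∞) * ENNReal.ofReal (floydEdgeLength f S g (g * s)) := by
        push_cast; ring
    _ ≤ _ := by gcongr; exact le_self_add

/-- For a doubling Floyd function the Floyd boundary does not depend on the generating set. -/
theorem FloydBoundary.nonempty_homeomorph_of_generators (hf : IsFloydFunction f)
    (hD : ∃ D : ℝ, ∀ n, f n ≤ D * f (2 * n)) (hS : IsFiniteGeneratingSet S)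
    (hT : IsFiniteGeneratingSet T) : Nonempty (FloydBoundary f S ≃ₜ FloydBoundary f T) :=
  FloydBoundary.nonempty_homeomorph
    ⟨⟨fun x => ⟨x.val⟩, fun x => ⟨x.val⟩, fun _ => rfl, fun _ => rfl⟩,
      hf.uniformContinuous_change_generators hD hS hT,
      hf.uniformContinuous_change_generators hD hT hS⟩

theorem IsFiniteGeneratingSet.image (hS : IsFiniteGeneratingSet S) (e : G ≃* H) :
    IsFiniteGeneratingSet (e '' S) := by
  refine ⟨hS.1.image e, ?_⟩
  have := MonoidHom.map_closure e.toMonoidHom S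
  rw [hS.2] at this
  refine Eq.trans this.symm ?_
  rw [← MonoidHom.range_eq_map]
  exact MonoidHom.range_eq_top.2 e.surjective

theorem wordLength_image_le (hS : Subgroup.closure S = ⊤)
    (e : G ≃* H) (hT : Subgroup.closure (e '' S) = ⊤) (g : G) :
    wordLength (e '' S) (e g) ≤ wordLength S g := by
  refine le_wordLength hS (fun g => wordLength (e '' S) (e g)) (by simp [wordLength_one])
    (fun g s hs => ?_) g
  have hs' : e s ∈ e '' S := ⟨s, hs, rfl⟩
  simp only [map_mul]
  exact ⟨wordLength_mul_gen_le hT hs' _, wordLength_le_mul_gen hT hs' _⟩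

theorem wordLength_image (hS : Subgroup.closure S = ⊤)
    (e : G ≃* H) (hT : Subgroup.closure (e '' S) = ⊤) (g : G) :
    wordLength (e '' S) (e g) = wordLength S g := by
  refine le_antisymm (wordLength_image_le hS e hT g) ?_
  have h : e.symm '' (e '' S) = S := by
    rw [← Set.image_comp]; simp
  have := wordLength_image_le hT e.symm (by rwa [h]) (e g)
  rwa [h, e.symm_apply_apply] at this

theorem IsFloydFunction.uniformContinuous_image (hf : IsFloydFunction f)
    (hS : Subgroup.closure S = ⊤) (e : G ≃* H) (hT : Subgroup.closure (e '' S) = ⊤) :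
    UniformContinuous fun x : FloydSpace f S => (⟨e x.val⟩ : FloydSpace f (e '' S)) := by
  refine (hf.lipschitzWith (C := 1) _ one_ne_zero fun g s hs => ?_).uniformContinuous
  rw [FloydSpace.edist_def]
  have h := floydEDist_mul_gen_le (f := f) (S := e '' S) ⟨s, hs, rfl⟩ (e g)
  rw [← map_mul, floydEdgeLength, wordLength_image hS e hT, wordLength_image hS e hT] at h
  rw [ENNReal.coe_one, one_mul]
  exact h

/-- A group isomorphism is a uniform equivalence of the Floyd metrics of corresponding generating
sets. -/
def FloydSpace.uniformEquivImage (hf : IsFloydFunction f) (hS : Subgroup.closure S = ⊤)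
    (e : G ≃* H) (hT : Subgroup.closure (e '' S) = ⊤) :
    FloydSpace f S ≃ᵤ FloydSpace f (e '' S) where
  toFun x := ⟨e x.val⟩
  invFun x := ⟨e.symm x.val⟩
  left_inv x := by simp
  right_inv x := by simp
  uniformContinuous_toFun := hf.uniformContinuous_image hS e hT
  uniformContinuous_invFun := by
    have h : e.symm '' (e '' S) = S := by
      rw [← Set.image_comp]; simp
    have := hf.uniformContinuous_image hT e.symm (by rwa [h])
    rwa [h] at this

end GeneratingSets

theorem List.exists_maximal_common_suffix {α : Type*} (u v : List α) :
    ∃ L, L <:+ u ∧ L <:+ v ∧ ∀ x, ¬ (x :: L <:+ u ∧ x :: L <:+ v) := by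
  by_contra! h
  have key : ∀ n, ∃ L, L <:+ u ∧ L <:+ v ∧ L.length = n := by
    intro n
    induction n with
    | zero => exact ⟨[], List.nil_suffix, List.nil_suffix, rfl⟩
    | succ n ih =>
      obtain ⟨L, h1, h2, h3⟩ := ih
      obtain ⟨x, h4, h5⟩ := h L h1 h2
      exact ⟨x :: L, h4, h5, by simp [h3]⟩
  obtain ⟨L, h1, -, h3⟩ := key (u.length + 1)
  have := h1.length_le
  omega

/-! ### Reduced words, word length and coset retractions in free products. -/

namespace Monoid.CoprodI

variable {ι : Type*} {M : ι → Type*} [∀ i, Group (M i)]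

/-- The union of generating sets of the factors of a free product. -/
def generators (S : ∀ i, Set (M i)) : Set (CoprodI M) :=
  ⋃ i, (of : M i →* CoprodI M) '' S i

theorem of_mem_generators {S : ∀ i, Set (M i)} {i : ι} {s : M i} (hs : s ∈ S i) :
    of s ∈ generators S :=
  Set.mem_iUnion.2 ⟨i, s, hs, rfl⟩

theorem isFiniteGeneratingSet_generators [Finite ι] {S : ∀ i, Set (M i)}
    (hS : ∀ i, IsFiniteGeneratingSet (S i)) : IsFiniteGeneratingSet (generators S) := by
  refine ⟨Set.finite_iUnion fun i => (hS i).1.image _, ?_⟩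
  rw [eq_top_iff]
  have h := range_eq_iSup (G := M) (fun i => (of : M i →* CoprodI M))
  rw [lift_of', MonoidHom.range_eq_top.2 Function.surjective_id] at h
  rw [h, iSup_le_iff]
  intro i
  rw [MonoidHom.range_eq_map, ← (hS i).2, MonoidHom.map_closure]
  exact Subgroup.closure_mono (Set.subset_iUnion (fun i => (of : M i →* CoprodI M) '' S i) i)

namespace Word

/-- The suffix of a reduced word. -/
def ofSuffix (w : Word M) (L : List (Σ i, M i)) (h : L <:+ w.toList) : Word M where
  toList := L
  ne_one l hl := w.ne_one l (h.subset hl)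
  chain_ne := w.chain_ne.suffix h

/-- The prefix of a reduced word. -/
def ofPrefix (w : Word M) (L : List (Σ i, M i)) (h : L <+: w.toList) : Word M where
  toList := L
  ne_one l hl := w.ne_one l (h.subset hl)
  chain_ne := w.chain_ne.prefix h

/-- The total length of the letters of a word. -/
noncomputable def listLength (S : ∀ i, Set (M i)) (l : List (Σ i, M i)) : ℕ :=
  (l.map fun x => wordLength (S x.1) x.2).sum

theorem listLength_append (S : ∀ i, Set (M i)) (l l' : List (Σ i, M i)) :
    listLength S (l ++ l') = listLength S l + listLength S l' := by
  simp [listLength]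

open Classical in
/-- The inverse of the letter of index `i` that stands right before the suffix `L` of a word, or `1`
if there is no such letter. -/
noncomputable def retract (L : List (Σ i, M i)) (i : ι) : List (Σ i, M i) → M i
  | [] => 1
  | x :: l => if l = L then (if h : x.1 = i then (h ▸ x.2)⁻¹ else 1) else retract L i l

theorem retract_of_length_le {L : List (Σ i, M i)} {i : ι} {l : List (Σ i, M i)}
    (h : l.length ≤ L.length) : retract L i l = 1 := by
  induction l with
  | nil => rfl
  | cons x l ih =>
    rw [List.length_cons] at h
    have hne : l ≠ L := fun hl => by rw [hl] at h; omega
    rw [retract, if_neg hne, ih (by omega)]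

theorem retract_append (L : List (Σ i, M i)) (i : ι) (m : M i) (u : List (Σ i, M i)) :
    retract L i (u ++ ⟨i, m⟩ :: L) = m⁻¹ := by
  induction u with
  | nil => simp [retract]
  | cons x u ih =>
    have hne : u ++ ⟨i, m⟩ :: L ≠ L := fun hl => by
      have := congrArg List.length hl
      simp at this
      omega
    rw [List.cons_append, retract, if_neg hne, ih]

/-- A nontrivial retraction detects that the word enters the coset at `L` through a letter of index
`i`. -/
theorem exists_append_of_retract_ne_one {L : List (Σ i, M i)} {i : ι} {l : List (Σ i, M i)}
    (h : retract L i l ≠ 1) : ∃ u m, l = u ++ ⟨i, m⟩ :: L := by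
  induction l with
  | nil => exact absurd rfl h
  | cons x l ih =>
    rw [retract] at h
    split_ifs at h with h1 h2
    · obtain ⟨j, m⟩ := x
      subst h2 h1
      exact ⟨[], m, rfl⟩
    · exact absurd rfl h
    · obtain ⟨u, m, rfl⟩ := ih h
      exact ⟨x :: u, m, rfl⟩

section Action

variable [DecidableEq ι] [∀ i, DecidableEq (M i)]

theorem toList_of_smul {i : ι} (m : M i) {w : Word M} (hw : w.fstIdx ≠ some i) :
    (of m • w).toList = if m = 1 then w.toList else ⟨i, m⟩ :: w.toList := by
  rw [of_smul_def, equivPair_eq_of_fstIdx_ne hw]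
  simp only [mul_one, rcons]
  split_ifs <;> rfl

open Classical in
theorem retract_of_smul (L : List (Σ i, M i)) (i : ι) {j : ι} (m : M j) {w : Word M}
    (hw : w.fstIdx ≠ some j) :
    retract L i (of m • w).toList =
      if w.toList = L then (if h : j = i then (h ▸ m)⁻¹ else 1) else retract L i w.toList := by
  rw [toList_of_smul m hw]
  by_cases hm : m = 1
  · rw [if_pos hm]
    split_ifs with h1 h2
    · subst h2
      rw [retract_of_length_le (congrArg List.length h1).le, hm]
      simp
    · exact retract_of_length_le (congrArg List.length h1).le
    · rfl
  · rw [if_neg hm, retract]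
    split_ifs <;> rfl

theorem listLength_of_smul (S : ∀ i, Set (M i)) {i : ι} (m : M i) {w : Word M}
    (hw : w.fstIdx ≠ some i) :
    listLength S (of m • w).toList = wordLength (S i) m + listLength S w.toList := by
  rw [toList_of_smul m hw]
  split_ifs with h
  · rw [h, wordLength_one, zero_add]
  · simp [listLength]

/-- The reduced word of the inverse of an element of a free product. -/
def ofInv (g : CoprodI M) : Word M := g⁻¹ • empty

theorem prod_ofInv (g : CoprodI M) : (ofInv g).prod = g⁻¹ := by
  rw [ofInv, prod_smul, prod_empty, mul_one]

theorem ofInv_prod_inv (w : Word M) : ofInv w.prod⁻¹ = w := by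
  rw [ofInv, inv_inv]
  exact equiv.apply_symm_apply w

theorem ofInv_mul (g h : CoprodI M) : ofInv (g * h) = h⁻¹ • ofInv g := by
  rw [ofInv, ofInv, mul_inv_rev, mul_smul]

/-- The reduced words of the end points of an edge differ at most in their first letters. -/
theorem exists_ofInv_eq (g : CoprodI M) {i : ι} (s : M i) :
    ∃ (m : M i) (w : Word M), w.fstIdx ≠ some i ∧ ofInv g = of m • w ∧
      ofInv (g * of s) = of (s⁻¹ * m) • w := by
  refine ⟨(equivPair i (ofInv g)).head, (equivPair i (ofInv g)).tail,
    (equivPair i (ofInv g)).fstIdx_ne, (equivPair_head_smul_equivPair_tail _).symm, ?_⟩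
  rw [ofInv_mul, map_mul, mul_smul, equivPair_head_smul_equivPair_tail, map_inv]

variable {S : ∀ i, Set (M i)}

/-- Multiplying out the letters gives one inequality. For the other, an edge changes at most one
letter, by a generator of its factor, so the total changes by at most `1`. -/
theorem wordLength_eq_listLength [Finite ι] (hS : ∀ i, IsFiniteGeneratingSet (S i))
    (g : CoprodI M) : wordLength (generators S) g = listLength S (ofInv g).toList := by
  have hG := (isFiniteGeneratingSet_generators hS).2
  refine le_antisymm ?_ ?_
  · have h1 : ∀ i, ∀ m : M i, wordLength (generators S) (of m) ≤ wordLength (S i) m := by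
      intro i
      refine le_wordLength (hS i).2 (fun m => wordLength (generators S) (of m))
        (by simp [wordLength_one]) fun m s hs => ?_
      simp only [map_mul]
      exact ⟨wordLength_mul_gen_le hG (of_mem_generators hs) _,
        wordLength_le_mul_gen hG (of_mem_generators hs) _⟩
    rw [← wordLength_inv hG, ← prod_ofInv, prod]
    generalize (ofInv g).toList = l
    induction l with
    | nil => simp [wordLength_one, listLength]
    | cons x l ih =>
      rw [List.map_cons, List.prod_cons, ← List.singleton_append, listLength_append]
      refine (wordLength_mul_le hG _ _).trans (add_le_add ?_ ih)
      simpa [listLength] using h1 x.1 x.2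
  · refine le_wordLength hG (fun g => listLength S (ofInv g).toList) ?_ ?_ g
    · simp [ofInv, listLength, empty]
    · intro g t ht
      obtain ⟨i, s, hs, rfl⟩ := Set.mem_iUnion.1 ht
      obtain ⟨m, w, hw, h1, h2⟩ := exists_ofInv_eq g s
      simp only [h1, h2, listLength_of_smul S _ hw]
      rw [← wordLength_inv (hS i).2 m, ← wordLength_inv (hS i).2 (s⁻¹ * m), mul_inv_rev, inv_inv]
      have h3 := wordLength_mul_gen_le (hS i).2 hs m⁻¹
      have h4 := wordLength_le_mul_gen (hS i).2 hs m⁻¹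
      omega

variable {f : ℕ → ℝ}

/-- The retraction of a free product onto a coset of a factor is uniformly continuous for the Floyd
metrics. -/
theorem uniformContinuous_retract [Finite ι] (hf : IsFloydFunction f)
    (hS : ∀ i, IsFiniteGeneratingSet (S i)) (L : List (Σ i, M i)) (i : ι) :
    UniformContinuous fun x : FloydSpace f (generators S) =>
      (⟨retract L i (ofInv x.val).toList⟩ : FloydSpace f (S i)) := by
  obtain ⟨C, hC, hCf⟩ := hf.exists_le_mul_add (listLength S L)
  refine (hf.lipschitzWith _ hC fun g t ht => ?_).uniformContinuous
  obtain ⟨j, s, hs, rfl⟩ := Set.mem_iUnion.1 ht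
  obtain ⟨m, w, hw, h1, h2⟩ := exists_ofInv_eq g s
  rw [FloydSpace.edist_def, floydEdgeLength, wordLength_eq_listLength hS,
    wordLength_eq_listLength hS, h1, h2, retract_of_smul _ _ _ hw, retract_of_smul _ _ _ hw,
    listLength_of_smul S _ hw, listLength_of_smul S _ hw]
  -- Only edges inside the coset at `L` with index `i` are not collapsed. Their lengths from `1`
  -- exceed those in the factor by `listLength S L`, which `C` absorbs.
  split_ifs with hL hj
  · subst hj
    have h3 := (floydEDist_mul_gen_le (f := f) hs m⁻¹).trans (hCf _)
    rw [← min_add_add_right, wordLength_inv (hS j).2,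
      ← wordLength_inv (hS j).2 (m⁻¹ * s), mul_inv_rev, inv_inv] at h3
    rw [hL, mul_inv_rev, inv_inv]
    exact h3
  · rw [floydEDist_self]; exact zero_le
  · rw [floydEDist_self]; exact zero_le

/-- The inclusion of a coset of a factor is `1`-Lipschitz. -/
theorem floydEDist_mul_of_le [Finite ι] (hf : IsFloydFunction f)
    (hS : ∀ i, IsFiniteGeneratingSet (S i)) {i : ι} {w : Word M} (hw : w.fstIdx ≠ some i)
    (m m' : M i) :
    floydEDist f (generators S) (w.prod⁻¹ * of m) (w.prod⁻¹ * of m') ≤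
      floydEDist f (S i) m m' := by
  have h := hf.lipschitzWith (S := S i) (C := 1)
    (fun x => (⟨w.prod⁻¹ * of x.val⟩ : FloydSpace f (generators S))) one_ne_zero ?_ ⟨m⟩ ⟨m'⟩
  · rw [ENNReal.coe_one, one_mul] at h
    exact h
  intro g s hs
  rw [FloydSpace.edist_def, ENNReal.coe_one, one_mul, map_mul, ← mul_assoc]
  refine (floydEDist_mul_gen_le (of_mem_generators hs) _).trans (ENNReal.ofReal_le_ofReal ?_)
  rw [mul_assoc, ← map_mul]
  have hle : ∀ n : M i, wordLength (S i) n ≤ wordLength (generators S) (w.prod⁻¹ * of n) := by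
    intro n
    rw [wordLength_eq_listLength hS, ofInv_mul, ofInv_prod_inv, ← map_inv,
      listLength_of_smul S _ hw, wordLength_inv (hS i).2]
    exact Nat.le_add_right _ _
  exact hf.antitone (min_le_min (hle _) (hle _))

/-- Lengths add up along a reduced word, so some geodesic from `1` to `W.prod⁻¹` passes through
`L.prod⁻¹`. -/
theorem floydEDist_prod_inv_le_floydTail [Finite ι] (hS : ∀ i, IsFiniteGeneratingSet (S i))
    {W L : Word M} (h : L.toList <:+ W.toList) :
    floydEDist f (generators S) L.prod⁻¹ W.prod⁻¹ ≤
      floydTail f (wordLength (generators S) L.prod⁻¹) := by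
  obtain ⟨u, hu⟩ := h
  let U : Word M := W.ofPrefix u ⟨_, hu⟩
  have hU : U.toList = u := rfl
  have hW : W.prod⁻¹ = L.prod⁻¹ * U.prod⁻¹ := by
    rw [← mul_inv_rev, prod, prod, prod, ← hu, hU, List.map_append, List.prod_append]
  rw [hW]
  refine floydEDist_mul_le_floydTail (isFiniteGeneratingSet_generators hS).2 _ _ ?_
  rw [← hW]
  simp only [wordLength_eq_listLength hS, ofInv_prod_inv]
  rw [← hu, listLength_append, add_comm, hU]

end Action

end Word

end Monoid.CoprodI

/-! ### The letterwise map between free products and its uniform continuity. -/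

namespace Monoid.CoprodI.Word

variable {ι : Type*} {M N : ι → Type*} [∀ i, Group (M i)] [∀ i, Group (N i)]

/-- The map of letters induced by maps of the factors, with letters read as inverses. -/
def mapLetter (φ : ∀ i, M i ≃ N i) (x : Σ i, M i) : Σ i, N i :=
  ⟨x.1, (φ x.1 x.2⁻¹)⁻¹⟩

theorem mapLetter_symm_mapLetter (φ : ∀ i, M i ≃ N i) (x : Σ i, M i) :
    mapLetter (fun i => (φ i).symm) (mapLetter φ x) = x := by
  obtain ⟨i, m⟩ := x
  refine Sigma.ext rfl (heq_of_eq ?_)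
  change ((φ i).symm ((φ i m⁻¹)⁻¹)⁻¹)⁻¹ = m
  rw [inv_inv, Equiv.symm_apply_apply, inv_inv]

/-- The map of reduced words that applies `mapLetter` to each letter. -/
def mapLetters (φ : ∀ i, M i ≃ N i) (hφ : ∀ i, φ i 1 = 1) (w : Word M) : Word N where
  toList := w.toList.map (mapLetter φ)
  ne_one := by
    intro l hl
    obtain ⟨x, hx, rfl⟩ := List.mem_map.1 hl
    intro h
    refine w.ne_one x hx ?_
    have h1 : φ x.1 x.2⁻¹ = φ x.1 1 := by rw [hφ]; exact inv_eq_one.1 h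
    exact inv_eq_one.1 ((φ x.1).injective h1)
  chain_ne := (List.isChain_map _).2 w.chain_ne

theorem mapLetters_symm (φ : ∀ i, M i ≃ N i) (hφ : ∀ i, φ i 1 = 1)
    (hφ' : ∀ i, (φ i).symm 1 = 1) (w : Word M) :
    mapLetters (fun i => (φ i).symm) hφ' (mapLetters φ hφ w) = w := by
  refine Word.ext ?_
  simp only [mapLetters, List.map_map]
  exact (List.map_congr_left fun x _ => mapLetter_symm_mapLetter φ x).trans (List.map_id _)

theorem fstIdx_mapLetters (φ : ∀ i, M i ≃ N i) (hφ : ∀ i, φ i 1 = 1) (w : Word M) :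
    (mapLetters φ hφ w).fstIdx = w.fstIdx := by
  simp only [fstIdx, mapLetters, List.head?_map, Option.map_map]
  rfl

/-- The vertex of the free product of the `N i` that corresponds to a reduced word. -/
def vertex (φ : ∀ i, M i ≃ N i) (hφ : ∀ i, φ i 1 = 1) (w : Word M) : CoprodI N :=
  (mapLetters φ hφ w).prod⁻¹

/-- Within the coset at `L` the map is `φ i` itself: a letter `m` marks the point with coordinate
`m⁻¹`. -/
theorem vertex_cons (φ : ∀ i, M i ≃ N i) (hφ : ∀ i, φ i 1 = 1) {X L : Word M} {i : ι} {m : M i}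
    (h : X.toList = ⟨i, m⟩ :: L.toList) :
    vertex φ hφ X = (mapLetters φ hφ L).prod⁻¹ * of (φ i m⁻¹) := by
  have h' : (mapLetters φ hφ X).toList = ⟨i, (φ i m⁻¹)⁻¹⟩ :: (mapLetters φ hφ L).toList :=
    congrArg (List.map (mapLetter φ)) h
  rw [vertex, prod, prod, h']
  simp

theorem fstIdx_ne_of_toList_eq_cons {X L : Word M} {i : ι} {m : M i}
    (h : X.toList = ⟨i, m⟩ :: L.toList) : L.fstIdx ≠ some i := by
  rw [fstIdx_ne_iff]
  have := X.chain_ne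
  rw [h, List.isChain_cons] at this
  exact this.1

theorem retract_ne_one_of_append {W : Word M} {u L : List (Σ i, M i)} {i : ι} {m : M i}
    (h : u ++ ⟨i, m⟩ :: L = W.toList) : retract L i W.toList ≠ 1 := by
  rw [← h, retract_append, Ne, inv_eq_one]
  exact W.ne_one ⟨i, m⟩ (by rw [← h]; simp)

variable [DecidableEq ι] [∀ i, DecidableEq (N i)]
  {S : ∀ i, Set (M i)} {T : ∀ i, Set (N i)} {f f' : ℕ → ℝ}

theorem vertex_injective (φ : ∀ i, M i ≃ N i) (hφ : ∀ i, φ i 1 = 1) :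
    Function.Injective (vertex φ hφ) := by
  intro w w' h
  have h1 := congrArg ofInv h
  rw [vertex, vertex, ofInv_prod_inv, ofInv_prod_inv] at h1
  have hφ' : ∀ i, (φ i).symm 1 = 1 := fun i => by rw [← hφ i, Equiv.symm_apply_apply]
  rw [← mapLetters_symm φ hφ hφ' w, h1, mapLetters_symm]

variable [Finite ι]

theorem floydEDist_vertex_le_floydTail (hT : ∀ i, IsFiniteGeneratingSet (T i))
    (φ : ∀ i, M i ≃ N i) (hφ : ∀ i, φ i 1 = 1) {W L : Word M} (h : L.toList <:+ W.toList) :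
    floydEDist f' (generators T) (vertex φ hφ L) (vertex φ hφ W) ≤
      floydTail f' (wordLength (generators T) (vertex φ hφ L)) :=
  floydEDist_prod_inv_le_floydTail hT (h.map _)

theorem floydEDist_vertex_cons_le (hf' : IsFloydFunction f')
    (hT : ∀ i, IsFiniteGeneratingSet (T i)) (φ : ∀ i, M i ≃ N i) (hφ : ∀ i, φ i 1 = 1)
    {X X' L : Word M} {i : ι} {m m' : M i} (h : X.toList = ⟨i, m⟩ :: L.toList)
    (h' : X'.toList = ⟨i, m'⟩ :: L.toList) :
    floydEDist f' (generators T) (vertex φ hφ X) (vertex φ hφ X') ≤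
      floydEDist f' (T i) (φ i m⁻¹) (φ i m'⁻¹) := by
  rw [vertex_cons φ hφ h, vertex_cons φ hφ h']
  refine floydEDist_mul_of_le hf' hT ?_ _ _
  rw [fstIdx_mapLetters]
  exact fstIdx_ne_of_toList_eq_cons h

/-- If every short enough suffix of `W` that is followed by a further letter can be continued by a
letter of the same factor in `W'`, then a suffix `X` of `W` that is not a suffix of `W'` gives
a point close to that of `W`. -/
theorem floydEDist_vertex_le_of_not_suffix (hT : ∀ i, IsFiniteGeneratingSet (T i))
    (φ : ∀ i, M i ≃ N i) (hφ : ∀ i, φ i 1 = 1) {n : ℕ} {W W' X : Word M}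
    (hW : ∀ L : Word M, wordLength (generators T) (vertex φ hφ L) ≤ n →
      ∀ i, retract L.toList i W.toList ≠ 1 → retract L.toList i W'.toList ≠ 1)
    (hX : X.toList <:+ W.toList) (hX' : ¬ X.toList <:+ W'.toList) :
    floydEDist f' (generators T) (vertex φ hφ X) (vertex φ hφ W) ≤ floydTail f' n := by
  rcases le_or_gt (wordLength (generators T) (vertex φ hφ X)) n with h | h
  · obtain ⟨u, hu⟩ := hX
    rcases List.eq_nil_or_concat' u with rfl | ⟨u', ⟨i, m⟩, rfl⟩
    · have : X = W := Word.ext hu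
      rw [this, floydEDist_self]
      exact zero_le
    · rw [List.append_assoc, List.singleton_append] at hu
      -- The letter of `W` just beyond `X` forces one in `W'` too, which would make `X` a suffix of
      -- `W'`.
      obtain ⟨v, m', hv⟩ := exists_append_of_retract_ne_one (hW X h i (retract_ne_one_of_append hu))
      exact absurd ⟨v ++ [⟨i, m'⟩], by simp [hv]⟩ hX'
  · exact (floydEDist_vertex_le_floydTail hT φ hφ hX).trans (floydTail_antitone f' h.le)

/-- The two words are compared at their longest common suffix `L`. If the image of `L` is far from
`1`, both images lie within a tail of it. Otherwise both words leave `L` through the same factor,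
the images of the two exit points are close by `hφu`, and by maximality of `L` each exit point has
its image within a tail of the image of its word. -/
theorem uniformContinuous_vertex [∀ i, DecidableEq (M i)] (hf : IsFloydFunction f) (hf' : IsFloydFunction f')
    (hS : ∀ i, IsFiniteGeneratingSet (S i)) (hT : ∀ i, IsFiniteGeneratingSet (T i))
    (φ : ∀ i, M i ≃ N i) (hφ : ∀ i, φ i 1 = 1)
    (hφu : ∀ i, UniformContinuous fun x : FloydSpace f (S i) =>
      (⟨φ i x.val⟩ : FloydSpace f' (T i))) :
    UniformContinuous fun x : FloydSpace f (generators S) =>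
      (⟨vertex φ hφ (ofInv x.val)⟩ : FloydSpace f' (generators T)) := by
  refine uniformity_basis_edist.tendsto_right_iff.2 fun ε hε => ?_
  have hε3 : 0 < ε / 3 := ENNReal.div_pos hε.ne' (by simp)
  obtain ⟨n, hn⟩ := hf'.exists_floydTail_lt hε3
  have hfin : {L : Word M | wordLength (generators T) (vertex φ hφ L) ≤ n}.Finite :=
    (finite_wordLength_le (isFiniteGeneratingSet_generators hT) n).preimage
      (vertex_injective φ hφ).injOn
  -- Finitely many suffixes and factors matter, so the conditions hold simultaneously; the first two
  -- use that `1` is isolated in each factor.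
  have hev : ∀ᶠ p in 𝓤 (FloydSpace f (generators S)),
      ∀ L ∈ {L : Word M | wordLength (generators T) (vertex φ hφ L) ≤ n}, ∀ i,
        (retract L.toList i (ofInv p.1.val).toList = 1 →
          retract L.toList i (ofInv p.2.val).toList = 1) ∧
        (retract L.toList i (ofInv p.2.val).toList = 1 →
          retract L.toList i (ofInv p.1.val).toList = 1) ∧
        floydEDist f' (T i) (φ i (retract L.toList i (ofInv p.1.val).toList))
          (φ i (retract L.toList i (ofInv p.2.val).toList)) < ε / 3 := by
    refine (eventually_all_finite hfin).2 fun L _ => eventually_all.2 fun i => ?_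
    have hr := uniformContinuous_retract hf hS L.toList i
    have h1 := hr.eventually (hf.eventually_uniformity_eq (S := S i) ⟨1⟩)
    have h2 := tendsto_swap_uniformity.eventually h1
    have h3 := ((hφu i).comp hr).eventually (edist_mem_uniformity hε3)
    filter_upwards [h1, h2, h3] with p h1 h2 h3
    exact ⟨fun h => congrArg FloydSpace.val (h1 (congrArg FloydSpace.mk h)),
      fun h => congrArg FloydSpace.val (h2 (congrArg FloydSpace.mk h)), h3⟩
  filter_upwards [hev] with p hp
  obtain ⟨⟨g⟩, ⟨h⟩⟩ := p
  simp only at hp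
  change floydEDist f' (generators T) (vertex φ hφ (ofInv g)) (vertex φ hφ (ofInv h)) < ε
  generalize ofInv g = W at hp ⊢
  generalize ofInv h = W' at hp ⊢
  have hW : ∀ L : Word M, wordLength (generators T) (vertex φ hφ L) ≤ n →
      ∀ i, retract L.toList i W.toList ≠ 1 → retract L.toList i W'.toList ≠ 1 :=
    fun L hL i => mt (hp L hL i).2.1
  have hW' : ∀ L : Word M, wordLength (generators T) (vertex φ hφ L) ≤ n →
      ∀ i, retract L.toList i W'.toList ≠ 1 → retract L.toList i W.toList ≠ 1 :=
    fun L hL i => mt (hp L hL i).1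
  obtain ⟨L₀, hL, hL', hmax⟩ := List.exists_maximal_common_suffix W.toList W'.toList
  obtain ⟨L, rfl⟩ : ∃ L : Word M, L.toList = L₀ := ⟨W.ofSuffix L₀ hL, rfl⟩
  rcases le_or_gt (wordLength (generators T) (vertex φ hφ L)) n with hLn | hLn
  · by_cases hWW : W = W'
    · rw [hWW, floydEDist_self]; exact hε
    obtain ⟨i, hi, hi'⟩ : ∃ i, retract L.toList i W.toList ≠ 1 ∧
        retract L.toList i W'.toList ≠ 1 := by
      obtain ⟨u, hu⟩ := hL
      obtain ⟨u', hu'⟩ := hL'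
      rcases List.eq_nil_or_concat' u with rfl | ⟨v, ⟨i, m⟩, rfl⟩
      · rcases List.eq_nil_or_concat' u' with rfl | ⟨v, ⟨i, m⟩, rfl⟩
        · exact absurd (Word.ext (hu.symm.trans hu')) hWW
        · rw [List.append_assoc, List.singleton_append] at hu'
          have := retract_ne_one_of_append hu'
          exact ⟨i, hW' L hLn i this, this⟩
      · rw [List.append_assoc, List.singleton_append] at hu
        have := retract_ne_one_of_append hu
        exact ⟨i, this, hW L hLn i this⟩
    obtain ⟨u, m, hu⟩ := exists_append_of_retract_ne_one hi
    obtain ⟨u', m', hu'⟩ := exists_append_of_retract_ne_one hi'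
    have hX : ⟨i, m⟩ :: L.toList <:+ W.toList := ⟨u, hu.symm⟩
    have hX' : ⟨i, m'⟩ :: L.toList <:+ W'.toList := ⟨u', hu'.symm⟩
    have hd := (hp L hLn i).2.2
    rw [hu, hu', retract_append, retract_append] at hd
    have h1 : floydEDist f' (generators T) (vertex φ hφ (W.ofSuffix _ hX)) (vertex φ hφ W) ≤ _ :=
      floydEDist_vertex_le_of_not_suffix hT φ hφ hW hX fun h => hmax _ ⟨hX, h⟩
    have h2 : floydEDist f' (generators T) (vertex φ hφ (W'.ofSuffix _ hX')) (vertex φ hφ W') ≤ _ :=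
      floydEDist_vertex_le_of_not_suffix hT φ hφ hW' hX' fun h => hmax _ ⟨h, hX'⟩
    have h3 : floydEDist f' (generators T) (vertex φ hφ (W.ofSuffix _ hX))
        (vertex φ hφ (W'.ofSuffix _ hX')) ≤ _ :=
      floydEDist_vertex_cons_le hf' hT φ hφ (L := L) rfl rfl
    rw [floydEDist_comm] at h1
    calc floydEDist f' (generators T) (vertex φ hφ W) (vertex φ hφ W')
        ≤ floydEDist f' (generators T) (vertex φ hφ W) (vertex φ hφ (W.ofSuffix _ hX)) +
          (floydEDist f' (generators T) (vertex φ hφ (W.ofSuffix _ hX))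
            (vertex φ hφ (W'.ofSuffix _ hX')) +
          floydEDist f' (generators T) (vertex φ hφ (W'.ofSuffix _ hX')) (vertex φ hφ W')) :=
        (floydEDist_triangle _ _ _ _ _).trans
          (add_le_add le_rfl (floydEDist_triangle _ _ _ _ _))
      _ < ε / 3 + (ε / 3 + ε / 3) :=
        ENNReal.add_lt_add (h1.trans_lt hn) (ENNReal.add_lt_add (h3.trans_lt hd) (h2.trans_lt hn))
      _ = ε := by rw [← add_assoc, ENNReal.add_thirds]
  · have h1 := (floydEDist_vertex_le_floydTail (f' := f') hT φ hφ hL).trans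
      (floydTail_antitone f' hLn.le)
    have h2 := (floydEDist_vertex_le_floydTail (f' := f') hT φ hφ hL').trans
      (floydTail_antitone f' hLn.le)
    rw [floydEDist_comm] at h1
    calc floydEDist f' (generators T) (vertex φ hφ W) (vertex φ hφ W')
        ≤ _ := floydEDist_triangle _ _ _ (vertex φ hφ L) _
      _ < ε / 3 + ε / 3 := ENNReal.add_lt_add (h1.trans_lt hn) (h2.trans_lt hn)
      _ ≤ ε / 3 + ε / 3 + ε / 3 := le_self_add
      _ = ε := ENNReal.add_thirds ε

end Monoid.CoprodI.Word

/-! ### The uniform equivalence of free products. -/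

namespace Monoid.CoprodI

variable {ι : Type*} {M N : ι → Type*} [∀ i, Group (M i)] [∀ i, Group (N i)] [Finite ι]
  {S : ∀ i, Set (M i)} {T : ∀ i, Set (N i)} {f f' : ℕ → ℝ}

/-- Based uniform equivalences of the Floyd metrics of the factors induce one of the free
products. -/
theorem nonempty_uniformEquiv (hf : IsFloydFunction f) (hf' : IsFloydFunction f')
    (hS : ∀ i, IsFiniteGeneratingSet (S i)) (hT : ∀ i, IsFiniteGeneratingSet (T i))
    (e : ∀ i, FloydSpace f (S i) ≃ᵤ FloydSpace f' (T i)) (he : ∀ i, e i ⟨1⟩ = ⟨1⟩) :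
    Nonempty (FloydSpace f (generators S) ≃ᵤ FloydSpace f' (generators T)) := by
  classical
  let φ : ∀ i, M i ≃ N i := fun i =>
    ⟨fun m => (e i ⟨m⟩).val, fun n => ((e i).symm ⟨n⟩).val,
      fun m => congrArg FloydSpace.val ((e i).symm_apply_apply ⟨m⟩),
      fun n => congrArg FloydSpace.val ((e i).apply_symm_apply ⟨n⟩)⟩
  have hφ : ∀ i, φ i 1 = 1 := fun i => congrArg FloydSpace.val (he i)
  have hφ' : ∀ i, (φ i).symm 1 = 1 := fun i => by rw [← hφ i, Equiv.symm_apply_apply]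
  refine ⟨⟨⟨fun x => ⟨Word.vertex φ hφ (Word.ofInv x.val)⟩,
    fun x => ⟨Word.vertex (fun i => (φ i).symm) hφ' (Word.ofInv x.val)⟩, fun x => ?_, fun x => ?_⟩,
    Word.uniformContinuous_vertex hf hf' hS hT φ hφ fun i => (e i).uniformContinuous,
    Word.uniformContinuous_vertex hf' hf hT hS _ hφ' fun i => (e i).symm.uniformContinuous⟩⟩
  · obtain ⟨g⟩ := x
    simp only [Word.vertex, Word.ofInv_prod_inv, Word.mapLetters_symm, Word.prod_ofInv, inv_inv]
  · obtain ⟨g⟩ := x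
    have := Word.mapLetters_symm (fun i => (φ i).symm) hφ' hφ (Word.ofInv g)
    simp only [Equiv.symm_symm] at this
    simp only [Word.vertex, Word.ofInv_prod_inv, this, Word.prod_ofInv, inv_inv]

end Monoid.CoprodI

-- From indexed to binary free products.

universe u v

/-- Two types as a family indexed by `Bool`. -/
def boolFamily (A : Type u) (B : Type v) : Bool → Type max u v
  | true => ULift.{v} A
  | false => ULift.{u} B

section BoolFamily

variable (A : Type u) (B : Type v) [Group A] [Group B]

instance boolFamily.instGroup : ∀ b, Group (boolFamily A B b)
  | true => inferInstanceAs (Group (ULift.{v} A))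
  | false => inferInstanceAs (Group (ULift.{u} B))

/-- The first group as a member of the family. -/
def boolFamily.trueEquiv : A ≃* boolFamily A B true := MulEquiv.ulift.{u, v}.symm

/-- The second group as a member of the family. -/
def boolFamily.falseEquiv : B ≃* boolFamily A B false := MulEquiv.ulift.{v, u}.symm

variable {A B}

/-- Two subsets as a family indexed by `Bool`. -/
def boolFamily.sets (S : Set A) (T : Set B) : ∀ b, Set (boolFamily A B b)
  | true => boolFamily.trueEquiv A B '' S
  | false => boolFamily.falseEquiv A B '' T

variable (A B)

/-- The map from the indexed to the binary free product, on each factor. -/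
def boolFamily.toCoprod : ∀ b, boolFamily A B b →* Monoid.Coprod A B
  | true => Monoid.Coprod.inl.comp (boolFamily.trueEquiv A B).symm.toMonoidHom
  | false => Monoid.Coprod.inr.comp (boolFamily.falseEquiv A B).symm.toMonoidHom

/-- The binary free product as an indexed free product. -/
def coprodEquivCoprodI : Monoid.Coprod A B ≃* Monoid.CoprodI (boolFamily A B) :=
  MonoidHom.toMulEquiv
    (Monoid.Coprod.lift
      ((Monoid.CoprodI.of (i := true)).comp (boolFamily.trueEquiv A B).toMonoidHom)
      ((Monoid.CoprodI.of (i := false)).comp (boolFamily.falseEquiv A B).toMonoidHom))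
    (Monoid.CoprodI.lift (boolFamily.toCoprod A B))
    (by
      refine Monoid.Coprod.hom_ext ?_ ?_ <;> ext x <;> simp [boolFamily.toCoprod])
    (by
      refine Monoid.CoprodI.ext_hom _ _ fun b => ?_
      cases b <;> ext x <;> simp [boolFamily.toCoprod])

variable {A B}

theorem coprodEquivCoprodI_image (S : Set A) (T : Set B) :
    coprodEquivCoprodI A B '' freeProductGenerators S T =
      Monoid.CoprodI.generators (boolFamily.sets S T) := by
  rw [freeProductGenerators, Set.image_union, Monoid.CoprodI.generators, Set.union_eq_iUnion]
  refine Set.iUnion_congr fun b => ?_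
  cases b
  · simp only [cond_false, boolFamily.sets, Set.image_image]
    refine Set.image_congr fun x _ => ?_
    simp [coprodEquivCoprodI]
  · simp only [cond_true, boolFamily.sets, Set.image_image]
    refine Set.image_congr fun x _ => ?_
    simp [coprodEquivCoprodI]

theorem boolFamily.isFiniteGeneratingSet_sets {S : Set A} {T : Set B}
    (hS : IsFiniteGeneratingSet S) (hT : IsFiniteGeneratingSet T) :
    ∀ b, IsFiniteGeneratingSet (boolFamily.sets S T b)
  | true => hS.image _
  | false => hT.image _

theorem isFiniteGeneratingSet_freeProductGenerators {S : Set A} {T : Set B}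
    (hS : IsFiniteGeneratingSet S) (hT : IsFiniteGeneratingSet T) :
    IsFiniteGeneratingSet (freeProductGenerators S T) := by
  have h := (Monoid.CoprodI.isFiniteGeneratingSet_generators
    (boolFamily.isFiniteGeneratingSet_sets hS hT)).image (coprodEquivCoprodI A B).symm
  rw [← coprodEquivCoprodI_image, ← Set.image_comp] at h
  simpa using h

theorem freeProduct_nonempty_uniformEquiv {S : Set A} {T : Set B}
    (hS : IsFiniteGeneratingSet S) (hT : IsFiniteGeneratingSet T) {f : ℕ → ℝ}
    (hf : IsFloydFunction f) :
    Nonempty (FloydSpace f (freeProductGenerators S T) ≃ᵤ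
      FloydSpace f (Monoid.CoprodI.generators (boolFamily.sets S T))) := by
  have hG := isFiniteGeneratingSet_freeProductGenerators hS hT
  rw [← coprodEquivCoprodI_image]
  exact ⟨FloydSpace.uniformEquivImage hf hG.2 _ (hG.image _).2⟩

end BoolFamily

theorem FloydSpace.exists_uniformEquiv_image {A A' B B' : Type*} [Group A] [Group A'] [Group B]
    [Group B'] {S : Set A} {T : Set B} (hS : IsFiniteGeneratingSet S)
    (hT : IsFiniteGeneratingSet T) {f f' : ℕ → ℝ} (hf : IsFloydFunction f)
    (hf' : IsFloydFunction f') (a : A ≃* A') (b : B ≃* B')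
    (h : ∃ e : FloydSpace f S ≃ᵤ FloydSpace f' T, e ⟨1⟩ = ⟨1⟩) :
    ∃ e : FloydSpace f (a '' S) ≃ᵤ FloydSpace f' (b '' T), e ⟨1⟩ = ⟨1⟩ := by
  obtain ⟨e, he⟩ := h
  refine ⟨((FloydSpace.uniformEquivImage hf hS.2 a (hS.image a).2).symm.trans e).trans
    (FloydSpace.uniformEquivImage hf' hT.2 b (hT.image b).2), ?_⟩
  change FloydSpace.mk (b (e ⟨a.symm 1⟩).val) = _
  rw [map_one, he, map_one]

/-! ### The main theorem. -/

theorem theorem4p1 {A₁ B₁ A₂ B₂ : Type*} [Group A₁] [Group B₁] [Group A₂] [Group B₂]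
    [Infinite A₁] [Infinite B₁] [Infinite A₂] [Infinite B₂]
    (SA₁ : Set A₁) (SB₁ : Set B₁) (SA₂ : Set A₂) (SB₂ : Set B₂)
    (hSA₁ : IsFiniteGeneratingSet SA₁) (hSB₁ : IsFiniteGeneratingSet SB₁)
    (hSA₂ : IsFiniteGeneratingSet SA₂) (hSB₂ : IsFiniteGeneratingSet SB₂)
    (f₁ f₂ : ℕ → ℝ) (hf₁ : IsFloydFunction f₁) (hf₂ : IsFloydFunction f₂)
    (hA : Nonempty (FloydBoundary f₁ SA₁ ≃ₜ FloydBoundary f₂ SA₂))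
    (hB : Nonempty (FloydBoundary f₁ SB₁ ≃ₜ FloydBoundary f₂ SB₂)) :
    Nonempty (FloydBoundary f₁ (freeProductGenerators SA₁ SB₁) ≃ₜ
      FloydBoundary f₂ (freeProductGenerators SA₂ SB₂)) ∧
    ((∃ D : ℝ, ∀ n, f₁ n ≤ D * f₁ (2 * n)) → (∃ D : ℝ, ∀ n, f₂ n ≤ D * f₂ (2 * n)) →
      ∀ (S₁ : Set (Monoid.Coprod A₁ B₁)) (S₂ : Set (Monoid.Coprod A₂ B₂)),
        IsFiniteGeneratingSet S₁ → IsFiniteGeneratingSet S₂ →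
        Nonempty (FloydBoundary f₁ S₁ ≃ₜ FloydBoundary f₂ S₂)) := by
  obtain ⟨hA⟩ := hA
  obtain ⟨hB⟩ := hB
  have key : ∀ b, ∃ e : FloydSpace f₁ (boolFamily.sets SA₁ SB₁ b) ≃ᵤ
      FloydSpace f₂ (boolFamily.sets SA₂ SB₂ b), e ⟨1⟩ = ⟨1⟩
    | true => FloydSpace.exists_uniformEquiv_image hSA₁ hSA₂ hf₁ hf₂ _ _
        (FloydSpace.exists_uniformEquiv_of_boundary hf₁ hf₂ hSA₁ hSA₂ hA)
    | false => FloydSpace.exists_uniformEquiv_image hSB₁ hSB₂ hf₁ hf₂ _ _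
        (FloydSpace.exists_uniformEquiv_of_boundary hf₁ hf₂ hSB₁ hSB₂ hB)
  choose e he using key
  obtain ⟨E⟩ := Monoid.CoprodI.nonempty_uniformEquiv hf₁ hf₂
    (boolFamily.isFiniteGeneratingSet_sets hSA₁ hSB₁)
    (boolFamily.isFiniteGeneratingSet_sets hSA₂ hSB₂) e he
  obtain ⟨E₁⟩ := freeProduct_nonempty_uniformEquiv hSA₁ hSB₁ hf₁
  obtain ⟨E₂⟩ := freeProduct_nonempty_uniformEquiv hSA₂ hSB₂ hf₂
  obtain ⟨h⟩ := FloydBoundary.nonempty_homeomorph ((E₁.trans E).trans E₂.symm)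
  refine ⟨⟨h⟩, fun hD₁ hD₂ S₁ S₂ hS₁ hS₂ => ?_⟩
  obtain ⟨h₁⟩ := FloydBoundary.nonempty_homeomorph_of_generators hf₁ hD₁ hS₁
    (isFiniteGeneratingSet_freeProductGenerators hSA₁ hSB₁)
  obtain ⟨h₂⟩ := FloydBoundary.nonempty_homeomorph_of_generators hf₂ hD₂
    (isFiniteGeneratingSet_freeProductGenerators hSA₂ hSB₂) hS₂
  exact ⟨(h₁.trans h).trans h₂⟩
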